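/- Let $p>3$ be a prime. Let $\Gamma_p:\mathbb{Z}_p\to\mathbb{Z}_p$ denote Morita's $p$-adic Gamma function, that is, the unique continuous function on $\mathbb{Z}_p$ with $$\Gamma_p(n)=(-1)^n\prod_{\substack{0\le k<n\\ \gcd(k,p)=1}}k\qquad\text{for all integers } n>1,$$ let $H_k=\sum_{j=1}^{k}\frac1j$ be the $k$-th harmonic number (with $H_0=0$), and let $q_p(2)=\frac{2^{p-1}-1}{p}$ be the Fermat quotient. Then $$\sum_{k=0}^{p-1}\binom{2k}{k}^2\frac{H_k}{32^k}\equiv \begin{cases} \Gamma_p\left(\frac12\right)\Gamma_p\left(\frac14\right)^2\left(2q_p(2)-p\,q_p(2)^2\right) & \text{if } p\equiv 1\pmod 4,\\[2mm] \frac12\,\Gamma_p\left(\frac12\right)\Gamma_p\left(\frac14\right)^2 & \text{if } p\equiv 3\pmod 4, \end{cases} \pmod{p^2},$$ where the congruence is in $\mathbb{Z}_p$, i.e. the difference of the two sides lies in $p^2\mathbb{Z}_p$. -/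

import Mathlib

open Filter Topology

/-- The sequence `n ↦ (-1)^n ∏_{0 ≤ k < n, (k,p)=1} k` that Morita's `p`-adic Gamma function
interpolates. -/
def moritaSeq (p n : ℕ) : ℤ :=
  (-1) ^ n * ∏ k ∈ (Finset.range n).filter (fun k => Nat.Coprime k p), (k : ℤ)

/-- Morita's `p`-adic Gamma function `Γ_p : ℤ_p → ℤ_p`, as the limit of `moritaSeq p n` as `n` runs
over natural numbers tending `p`-adically to `x`. For odd `p` it is the unique continuous
function on `ℤ_p` with `Γ_p(n) = moritaSeq p n` for all natural numbers `n > 1`: see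
`padicGamma_natCast`, `continuous_padicGamma`, `eq_padicGamma`. -/
noncomputable def padicGamma (p : ℕ) [Fact p.Prime] (x : ℤ_[p]) : ℤ_[p] :=
  limUnder (comap (Nat.cast : ℕ → ℤ_[p]) (𝓝 x)) (fun n => ((moritaSeq p n : ℤ) : ℤ_[p]))

/-- The Fermat quotient `q_p(a) = (a^(p-1) - 1) / p`, as a rational number. -/
def fermatQuotient (p : ℕ) (a : ℤ) : ℚ := ((a : ℚ) ^ (p - 1) - 1) / p

/-- Congruence modulo `p^n` of `p`-adic numbers: the difference lies in `p^n ℤ_p`. -/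
def PadicModEq (p : ℕ) [Fact p.Prime] (n : ℕ) (a b : ℚ_[p]) : Prop :=
  ∃ z : ℤ_[p], a - b = (p : ℚ_[p]) ^ n * (z : ℚ_[p])

theorem units_sq_eq_one_aux (p : ℕ) [Fact p.Prime] (hp : p ≠ 2) (N : ℕ)
    (u : (ZMod (p ^ N))ˣ) (h : u * u = 1) : u = 1 ∨ u = -1 := by
  have hpp : p.Prime := Fact.out
  obtain ⟨a, ha⟩ := ZMod.intCast_surjective (u : ZMod (p ^ N))
  have h1 : ((((a - 1) * (a + 1) : ℤ)) : ZMod (p ^ N)) = 0 := by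
    have h2 : (u : ZMod (p ^ N)) * u = 1 := by
      rw [← Units.val_mul, h, Units.val_one]
    push_cast
    rw [ha]
    linear_combination h2
  rw [ZMod.intCast_zmod_eq_zero_iff_dvd] at h1
  push_cast at h1
  by_cases hd : (p : ℤ) ∣ a - 1
  · left
    have hnd : ¬ (p : ℤ) ∣ a + 1 := by
      intro hd2
      have h3 : (p : ℤ) ∣ 2 := by
        have := dvd_sub hd2 hd
        ring_nf at this
        exact this
      have h4 : p ∣ 2 := by exact_mod_cast h3
      exact hp ((Nat.prime_dvd_prime_iff_eq hpp Nat.prime_two).1 h4)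
    have hc : IsCoprime ((p : ℤ) ^ N) (a + 1) :=
      IsCoprime.pow_left ((Prime.coprime_iff_not_dvd (Nat.prime_iff_prime_int.1 hpp)).2 hnd)
    have h5 := hc.dvd_of_dvd_mul_right h1
    have h6 : ((a - 1 : ℤ) : ZMod (p ^ N)) = 0 := by
      rw [ZMod.intCast_zmod_eq_zero_iff_dvd]; exact_mod_cast h5
    push_cast at h6
    ext
    rw [← ha, Units.val_one]
    exact sub_eq_zero.1 h6
  · right
    have hc : IsCoprime ((p : ℤ) ^ N) (a - 1) :=
      IsCoprime.pow_left ((Prime.coprime_iff_not_dvd (Nat.prime_iff_prime_int.1 hpp)).2 hd)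
    have h5 := hc.dvd_of_dvd_mul_left h1
    have h6 : ((a + 1 : ℤ) : ZMod (p ^ N)) = 0 := by
      rw [ZMod.intCast_zmod_eq_zero_iff_dvd]; exact_mod_cast h5
    push_cast at h6
    ext
    rw [← ha, Units.val_neg, Units.val_one]
    exact eq_neg_of_add_eq_zero_left h6

theorem prod_units_aux (p : ℕ) [Fact p.Prime] (hp : p ≠ 2) (N : ℕ) :
    ∏ u : (ZMod (p ^ N))ˣ, u = -1 := by
  classical
  have key : ∏ u ∈ Finset.univ.erase (-1 : (ZMod (p ^ N))ˣ), u = 1 :=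
    Finset.prod_involution (fun u _ => u⁻¹) (by simp)
      (fun u hu hne heq => by
        have h2 : u * u = 1 := by
          nth_rewrite 1 [← heq]
          exact inv_mul_cancel u
        rcases units_sq_eq_one_aux p hp N u h2 with h | h
        · exact hne h
        · exact (Finset.mem_erase.1 hu).1 h)
      (fun u hu => by simpa [inv_eq_iff_eq_inv] using hu)
      (fun u _ => inv_inv u)
  rw [← Finset.mul_prod_erase _ _ (Finset.mem_univ (-1 : (ZMod (p ^ N))ˣ)), key, mul_one]

theorem moritaSeq_cast_aux (p N : ℕ) (hN : N ≠ 0) (n : ℕ) (g : ZMod (p ^ N) → ZMod (p ^ N))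
    (hg : ∀ x, IsUnit x → g x = x) (hg' : ∀ x, ¬ IsUnit x → g x = 1) :
    ((moritaSeq p n : ℤ) : ZMod (p ^ N)) =
      (-1) ^ n * ∏ k ∈ Finset.range n, g ((k : ℕ) : ZMod (p ^ N)) := by
  unfold moritaSeq
  push_cast
  rw [Finset.prod_filter]
  congr 1
  refine Finset.prod_congr rfl fun k _ => ?_
  have hk : IsUnit ((k : ℕ) : ZMod (p ^ N)) ↔ Nat.Coprime k p := by
    rw [ZMod.isUnit_iff_coprime, Nat.coprime_pow_right_iff (Nat.pos_of_ne_zero hN)]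
  by_cases h : Nat.Coprime k p
  · rw [if_pos h, hg _ (hk.2 h)]
  · rw [if_neg h, hg' _ (fun h' => h (hk.1 h'))]

theorem moritaSeq_add_aux (p : ℕ) [Fact p.Prime] (hp : p ≠ 2) (N : ℕ) (hN : N ≠ 0) (n : ℕ) :
    ((moritaSeq p (n + p ^ N) : ℤ) : ZMod (p ^ N)) = ((moritaSeq p n : ℤ) : ZMod (p ^ N)) := by
  classical
  have hpp : p.Prime := Fact.out
  set g : ZMod (p ^ N) → ZMod (p ^ N) := fun x => if IsUnit x then x else 1 with hg
  have hg1 : ∀ x, IsUnit x → g x = x := fun x hx => by simp [hg, hx]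
  have hg2 : ∀ x, ¬ IsUnit x → g x = 1 := fun x hx => by simp [hg, hx]
  rw [moritaSeq_cast_aux p N hN _ g hg1 hg2, moritaSeq_cast_aux p N hN _ g hg1 hg2,
    Finset.prod_range_add, pow_add, ((hpp.odd_of_ne_two hp).pow (n := N)).neg_one_pow]
  have h1 : ∏ i ∈ Finset.range (p ^ N), g (((n + i : ℕ)) : ZMod (p ^ N)) =
      ∏ x : ZMod (p ^ N), g (n + x) := by
    refine Finset.prod_bij (fun i _ => ((i : ℕ) : ZMod (p ^ N))) (fun _ _ => Finset.mem_univ _)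
      ?_ ?_ ?_
    · intro a ha b hb hab
      rw [ZMod.natCast_eq_natCast_iff'] at hab
      rwa [Nat.mod_eq_of_lt (Finset.mem_range.1 ha), Nat.mod_eq_of_lt (Finset.mem_range.1 hb)]
        at hab
    · intro x _
      exact ⟨x.val, Finset.mem_range.2 (ZMod.val_lt x), ZMod.natCast_zmod_val x⟩
    · intro i _
      simp [hg]
  have h2 : ∏ x : ZMod (p ^ N), g (n + x) = ∏ x : ZMod (p ^ N), g x :=
    Fintype.prod_equiv (Equiv.addLeft (n : ZMod (p ^ N))) _ _ (fun _ => rfl)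
  have h3 : ∏ x : ZMod (p ^ N), g x = -1 := by
    have h4 : ∏ u : (ZMod (p ^ N))ˣ, (u : ZMod (p ^ N)) = -1 := by
      rw [← Units.coe_prod, prod_units_aux p hp N, Units.val_neg, Units.val_one]
    rw [← h4, hg, ← Finset.prod_filter]
    symm
    refine Finset.prod_bij (fun u _ => (u : ZMod (p ^ N))) ?_ ?_ ?_ ?_
    · intro u _
      simp
    · intro a _ b _ hab
      exact Units.ext hab
    · intro x hx
      obtain ⟨u, rfl⟩ := (Finset.mem_filter.1 hx).2
      exact ⟨u, Finset.mem_univ _, rfl⟩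
    · intro _ _
      rfl
  rw [h1, h2, h3]
  ring

theorem moritaSeq_congr_aux (p : ℕ) [Fact p.Prime] (hp : p ≠ 2) (N : ℕ) (hN : N ≠ 0) (m n : ℕ)
    (h : (m : ZMod (p ^ N)) = n) :
    ((moritaSeq p m : ℤ) : ZMod (p ^ N)) = ((moritaSeq p n : ℤ) : ZMod (p ^ N)) := by
  have hmul : ∀ a t : ℕ, ((moritaSeq p (a + t * p ^ N) : ℤ) : ZMod (p ^ N)) =
      ((moritaSeq p a : ℤ) : ZMod (p ^ N)) := by
    intro a t
    induction t with
    | zero => simp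
    | succ t ih => rw [Nat.succ_mul, ← add_assoc, moritaSeq_add_aux p hp N hN, ih]
  rw [ZMod.natCast_eq_natCast_iff'] at h
  have hm := hmul (m % p ^ N) (m / p ^ N)
  have hn := hmul (n % p ^ N) (n / p ^ N)
  rw [Nat.mod_add_div'] at hm hn
  rw [hm, hn, h]

theorem toZModPow_eq_iff_aux (p : ℕ) [Fact p.Prime] (N : ℕ) (x y : ℤ_[p]) :
    PadicInt.toZModPow N x = PadicInt.toZModPow N y ↔ ‖x - y‖ ≤ (p : ℝ) ^ (-N : ℤ) := by
  rw [PadicInt.norm_le_pow_iff_mem_span_pow, ← PadicInt.ker_toZModPow, RingHom.mem_ker, map_sub,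
    sub_eq_zero]

theorem comap_natCast_neBot_aux (p : ℕ) [Fact p.Prime] (x : ℤ_[p]) :
    (comap (Nat.cast : ℕ → ℤ_[p]) (𝓝 x)).NeBot := by
  rw [comap_neBot_iff]
  intro t ht
  obtain ⟨_, h1, n, rfl⟩ := mem_closure_iff_nhds.1 (PadicInt.denseRange_natCast x) t ht
  exact ⟨n, h1⟩

theorem exists_tendsto_moritaSeq (p : ℕ) [Fact p.Prime] (hp : p ≠ 2) (x : ℤ_[p]) :
    ∃ y : ℤ_[p], Tendsto (fun n => ((moritaSeq p n : ℤ) : ℤ_[p]))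
      (comap (Nat.cast : ℕ → ℤ_[p]) (𝓝 x)) (𝓝 y) := by
  have : (comap (Nat.cast : ℕ → ℤ_[p]) (𝓝 x)).NeBot :=
    comap_natCast_neBot_aux p x
  refine cauchy_map_iff_exists_tendsto.1 ?_
  rw [Metric.cauchy_iff]
  refine ⟨inferInstance, fun ε hε => ?_⟩
  obtain ⟨N, hN⟩ := PadicInt.exists_pow_neg_lt p hε
  have hp1 : (1 : ℝ) < p := by exact_mod_cast (Fact.out : p.Prime).one_lt
  have hN' : (p : ℝ) ^ (-((N + 1 : ℕ)) : ℤ) < ε := by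
    refine lt_of_le_of_lt (zpow_le_zpow_right₀ hp1.le ?_) hN
    push_cast; linarith
  have hpos : (0 : ℝ) < (p : ℝ) ^ (-((N + 1 : ℕ)) : ℤ) := zpow_pos (by linarith) _
  refine ⟨_, image_mem_map (preimage_mem_comap (Metric.ball_mem_nhds x hpos)), ?_⟩
  rintro _ ⟨m, hm, rfl⟩ _ ⟨n, hn, rfl⟩
  rw [dist_eq_norm]
  refine lt_of_le_of_lt ((toZModPow_eq_iff_aux p (N + 1) _ _).1 ?_) hN'
  have hm' := (toZModPow_eq_iff_aux p (N + 1) (m : ℤ_[p]) x).2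
    (by rw [← dist_eq_norm]; exact (Metric.mem_ball.1 hm).le)
  have hn' := (toZModPow_eq_iff_aux p (N + 1) (n : ℤ_[p]) x).2
    (by rw [← dist_eq_norm]; exact (Metric.mem_ball.1 hn).le)
  have hmn := hm'.trans hn'.symm
  rw [map_natCast, map_natCast] at hmn
  simp only [map_intCast]
  exact moritaSeq_congr_aux p hp (N + 1) (Nat.succ_ne_zero N) m n hmn

theorem tendsto_padicGamma (p : ℕ) [Fact p.Prime] (hp : p ≠ 2) (x : ℤ_[p]) :
    Tendsto (fun n => ((moritaSeq p n : ℤ) : ℤ_[p]))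
      (comap (Nat.cast : ℕ → ℤ_[p]) (𝓝 x)) (𝓝 (padicGamma p x)) :=
  tendsto_nhds_limUnder (exists_tendsto_moritaSeq p hp x)

/-- `Γ_p` extends the sequence. -/
theorem padicGamma_natCast (p : ℕ) [Fact p.Prime] (hp : p ≠ 2) (n : ℕ) :
    padicGamma p (n : ℤ_[p]) = ((moritaSeq p n : ℤ) : ℤ_[p]) := by
  have h : pure n ≤ comap (Nat.cast : ℕ → ℤ_[p]) (𝓝 (n : ℤ_[p])) := by
    rw [← map_le_iff_le_comap, map_pure]
    exact pure_le_nhds _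
  exact tendsto_nhds_unique ((tendsto_padicGamma p hp n).mono_left h)
    (tendsto_pure_nhds _ n)

theorem toZModPow_padicGamma_aux (p : ℕ) [Fact p.Prime] (hp : p ≠ 2) (N : ℕ) (hN : N ≠ 0)
    (x : ℤ_[p]) (n : ℕ) (h : PadicInt.toZModPow N x = n) :
    PadicInt.toZModPow N (padicGamma p x) = ((moritaSeq p n : ℤ) : ZMod (p ^ N)) := by
  have : (comap (Nat.cast : ℕ → ℤ_[p]) (𝓝 x)).NeBot :=
    comap_natCast_neBot_aux p x
  have hp1 : (1 : ℝ) < p := by exact_mod_cast (Fact.out : p.Prime).one_lt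
  have hpos : (0 : ℝ) < (p : ℝ) ^ (-N : ℤ) := zpow_pos (by linarith) _
  have e1 := (tendsto_padicGamma p hp x).eventually (Metric.ball_mem_nhds _ hpos)
  have e2 : ∀ᶠ m : ℕ in comap (Nat.cast : ℕ → ℤ_[p]) (𝓝 x),
      (m : ℤ_[p]) ∈ Metric.ball x ((p : ℝ) ^ (-N : ℤ)) :=
    preimage_mem_comap (Metric.ball_mem_nhds x hpos)
  obtain ⟨m, h1, h2⟩ := (e1.and e2).exists
  have h1' := (toZModPow_eq_iff_aux p N _ (padicGamma p x)).2
    (by rw [← dist_eq_norm]; exact (Metric.mem_ball.1 h1).le)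
  have h2' := (toZModPow_eq_iff_aux p N (m : ℤ_[p]) x).2
    (by rw [← dist_eq_norm]; exact (Metric.mem_ball.1 h2).le)
  rw [map_natCast, h] at h2'
  rw [← h1', map_intCast]
  exact moritaSeq_congr_aux p hp N hN m n h2'

/-- `Γ_p` is continuous on `ℤ_p`. -/
theorem continuous_padicGamma (p : ℕ) [Fact p.Prime] (hp : p ≠ 2) :
    Continuous (padicGamma p) := by
  rw [Metric.continuous_iff]
  intro x ε hε
  obtain ⟨N, hN⟩ := PadicInt.exists_pow_neg_lt p hε
  have hp1 : (1 : ℝ) < p := by exact_mod_cast (Fact.out : p.Prime).one_lt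
  have hN' : (p : ℝ) ^ (-((N + 1 : ℕ)) : ℤ) < ε := by
    refine lt_of_le_of_lt (zpow_le_zpow_right₀ hp1.le ?_) hN
    push_cast; linarith
  refine ⟨(p : ℝ) ^ (-((N + 1 : ℕ)) : ℤ), zpow_pos (by linarith) _, fun y hy => ?_⟩
  rw [dist_eq_norm] at hy ⊢
  refine lt_of_le_of_lt ((toZModPow_eq_iff_aux p (N + 1) _ _).1 ?_) hN'
  have h1 := (toZModPow_eq_iff_aux p (N + 1) y x).2 hy.le
  have h2 : PadicInt.toZModPow (N + 1) x =
      (((PadicInt.toZModPow (N + 1) x).val : ℕ) : ZMod (p ^ (N + 1))) :=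
    (ZMod.natCast_zmod_val _).symm
  rw [toZModPow_padicGamma_aux p hp (N + 1) (Nat.succ_ne_zero N) x _ h2,
    toZModPow_padicGamma_aux p hp (N + 1) (Nat.succ_ne_zero N) y _ (h1.trans h2)]

/-- `Γ_p` is the only continuous function on `ℤ_p` that extends the sequence from the natural
numbers `n > 1`. -/
theorem eq_padicGamma (p : ℕ) [Fact p.Prime] (hp : p ≠ 2) (f : ℤ_[p] → ℤ_[p])
    (hf : Continuous f) (h : ∀ n : ℕ, 1 < n → f n = ((moritaSeq p n : ℤ) : ℤ_[p])) :
    f = padicGamma p := by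
  have hppos : 0 < p := (Fact.out : p.Prime).pos
  have hlim : ∀ n : ℕ, Tendsto (fun k : ℕ => ((n : ℤ_[p]) + (p : ℤ_[p]) ^ k)) atTop
      (𝓝 (n : ℤ_[p])) := by
    intro n
    have h0 : Tendsto (fun k : ℕ => (p : ℤ_[p]) ^ k) atTop (𝓝 0) :=
      tendsto_pow_atTop_nhds_zero_of_norm_lt_one (PadicInt.norm_lt_one_iff_dvd _ |>.2 dvd_rfl)
    simpa using h0.const_add (n : ℤ_[p])
  have hg := continuous_padicGamma p hp
  refine PadicInt.denseRange_natCast.equalizer hf hg (funext fun n => ?_)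
  refine tendsto_nhds_unique ((hf.tendsto _).comp (hlim n))
    (((hg.tendsto _).comp (hlim n)).congr' ?_)
  filter_upwards [eventually_ge_atTop 1] with k hk
  have h1 : 1 < n + p ^ k :=
    lt_of_lt_of_le (Nat.one_lt_pow (by omega) (Fact.out : p.Prime).one_lt) (Nat.le_add_left _ _)
  have h2 := h (n + p ^ k) h1
  have h3 := padicGamma_natCast p hp (n + p ^ k)
  push_cast at h2 h3
  simp only [Function.comp]
  rw [h2, h3]

/-- For a prime `p > 3`, `PadicInt.inv 2` and `PadicInt.inv 4` are the genuine `1/2`, `1/4`. -/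
theorem inv_two_four (p : ℕ) [Fact p.Prime] (hp : 3 < p) :
    (2 : ℤ_[p]) * PadicInt.inv 2 = 1 ∧ (4 : ℤ_[p]) * PadicInt.inv 4 = 1 := by
  have hpp : p.Prime := Fact.out
  have h2 : Nat.Coprime p 2 := (Nat.coprime_primes hpp Nat.prime_two).2 (by omega)
  have n2 : ‖((2 : ℕ) : ℤ_[p])‖ = 1 := PadicInt.norm_natCast_eq_one_iff.2 h2
  have n4 : ‖((4 : ℕ) : ℤ_[p])‖ = 1 := PadicInt.norm_natCast_eq_one_iff.2 (h2.pow_right 2)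
  exact ⟨PadicInt.mul_inv (by exact_mod_cast n2), PadicInt.mul_inv (by exact_mod_cast n4)⟩

/-! Put `p = 2n + 1`. Modulo `p²` the square `C(2k,k)²` agrees with `C(n+k,2k) C(2k,k) (-16)^k`
(`choose_two_mul_sq_modEq`), so dividing by `32^k` turns the sum into `∑ C(n,k) C(n+k,k) (-1/2)^k
H_k`. Without `H_k` this is the Legendre value `P_n(0)`.

The harmonic sum `L_n` has an exact evaluation over `ℚ`. Bonnet's recurrence and `P'_{n+2} - P'_n =
(2n+3) P_{n+1}`, read on coefficients, give `(n+2) L_{n+2} + (n+1) L_n = P_{n+2}(0) - P_n(0)`. Hence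
`L_{2m} = P_{2m}(0) H_{2m}`, while for odd degree the right side vanishes and `L_{2m+1}` is a
quotient of factorials (`legendreHarmonic_even`, `legendreHarmonic_odd`).

It remains to compare with `Γ_p` modulo `p²`. Since `(p²+1)/2` and `(3p²+1)/4` are natural numbers
congruent to `1/2` and `1/4`, the Gamma values become powers of `(p-1)!` times factorials times
corrections `1 + p t H_a` (`toZModPow_padicGamma_inv`). All corrections are first order in `p`. The
congruences `H_n ≡ -2q + p q²` modulo `p²` and `2 H_{⌊p/4⌋} ≡ 3 H_n` modulo `p`, with `q = q_p(2)`,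
express them through `p H_n` alone, and the coefficients then balance (`gamma_product_even`,
`gamma_product_odd`). When `p = 4m+1` this says `P_{2m}(0) ≡ -Γ_p(1/2) Γ_p(1/4)²`, and the sign
cancels that of `H_n`. -/

/-! ### Legendre polynomials at the origin and their harmonic variant -/

/-- The coefficient `C(n, k) C(n + k, k)` of the shifted Legendre polynomial. -/
def legendreCoeff (n k : ℕ) : ℚ := ((n + k).choose (2 * k) : ℚ) * ((2 * k).choose k : ℚ)

theorem legendreCoeff_zero_right (n : ℕ) : legendreCoeff n 0 = 1 := by
  simp [legendreCoeff]

theorem legendreCoeff_eq_zero {n k : ℕ} (h : n < k) : legendreCoeff n k = 0 := by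
  simp [legendreCoeff, Nat.choose_eq_zero_of_lt (show n + k < 2 * k by omega)]

theorem legendreCoeff_succ_left (n k : ℕ) :
    ((n : ℚ) + 1 - k) * legendreCoeff (n + 1) k = (n + 1 + k) * legendreCoeff n k := by
  rcases le_or_gt k (n + 1) with h | h
  · have h1 := Nat.choose_mul_succ_eq (n + k) (2 * k)
    have h2 : n + k + 1 - 2 * k = n + 1 - k := by omega
    rw [h2] at h1
    have h3 := congrArg (Nat.cast : ℕ → ℚ) h1
    push_cast [Nat.cast_sub h] at h3
    unfold legendreCoeff
    rw [show n + 1 + k = n + k + 1 by ring]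
    linear_combination -((2 * k).choose k : ℚ) * h3
  · rw [legendreCoeff_eq_zero h, legendreCoeff_eq_zero (by omega : n < k)]
    simp

theorem legendreCoeff_succ_sub (n k : ℕ) :
    legendreCoeff (n + 1) (k + 1) - legendreCoeff n (k + 1) =
      ((2 * (k + 1)).choose (k + 1) : ℚ) * ((n + k + 1).choose (2 * k + 1) : ℚ) := by
  unfold legendreCoeff
  have h : (n + 1 + (k + 1)).choose (2 * (k + 1)) =
      (n + k + 1).choose (2 * k + 1) + (n + (k + 1)).choose (2 * (k + 1)) := by
    rw [show n + 1 + (k + 1) = n + k + 1 + 1 by ring, show 2 * (k + 1) = 2 * k + 1 + 1 by ring,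
      Nat.choose_succ_succ]
    rfl
  rw [h]
  push_cast
  ring

/-- Coefficient form of `P'_{n+2} - P'_n = (2n+3) P_{n+1}` in the variable `y = (x-1)/2`; the extra
2 comes from `d/dy = 2 d/dx`. -/
theorem legendreCoeff_add_two_sub (n k : ℕ) :
    ((k : ℚ) + 1) * (legendreCoeff (n + 2) (k + 1) - legendreCoeff n (k + 1)) =
      2 * (2 * n + 3) * legendreCoeff (n + 1) k := by
  have h1 := legendreCoeff_succ_sub n k
  have h2 := legendreCoeff_succ_sub (n + 1) k
  have h3 := congrArg (Nat.cast : ℕ → ℚ) (Nat.succ_mul_centralBinom_succ k)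
  have h4 := congrArg (Nat.cast : ℕ → ℚ) (Nat.add_one_mul_choose_eq (n + 1 + k) (2 * k))
  have h5 : (2 * (k : ℚ) + 1) * ((n + k + 1).choose (2 * k + 1) : ℚ) =
      (n + 1 - k) * ((n + 1 + k).choose (2 * k) : ℚ) := by
    rcases le_or_gt k (n + 1) with h | h
    · have h1 := Nat.choose_succ_right_eq (n + 1 + k) (2 * k)
      rw [show n + 1 + k - 2 * k = n + 1 - k by omega] at h1
      have h3 := congrArg (Nat.cast : ℕ → ℚ) h1
      push_cast [Nat.cast_sub h] at h3
      rw [show n + k + 1 = n + 1 + k by ring]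
      linear_combination h3
    · rw [Nat.choose_eq_zero_of_lt (by omega), Nat.choose_eq_zero_of_lt (by omega)]
      simp
  simp only [Nat.centralBinom] at h3
  push_cast at h3 h4
  have h6 : legendreCoeff (n + 2) (k + 1) - legendreCoeff n (k + 1) =
      ((2 * (k + 1)).choose (k + 1) : ℚ) * (((n + 1 + k + 1).choose (2 * k + 1) : ℚ) +
        ((n + k + 1).choose (2 * k + 1) : ℚ)) := by
    rw [show n + 2 = n + 1 + 1 by ring]
    linear_combination h1 + h2
  rw [h6, ← mul_assoc, h3, legendreCoeff]
  linear_combination 2 * ((2 * k).choose k : ℚ) * (h5 - h4)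

/-- Bonnet's recurrence with `x = 1 + 2y`, compared at `y^(k+1)`. -/
theorem legendreCoeff_three_term (n k : ℕ) :
    ((n : ℚ) + 2) * legendreCoeff (n + 2) (k + 1) + (n + 1) * legendreCoeff n (k + 1) =
      (2 * n + 3) * (legendreCoeff (n + 1) (k + 1) + 2 * legendreCoeff (n + 1) k) := by
  have h1 := legendreCoeff_add_two_sub n k
  have h2 := legendreCoeff_succ_left n (k + 1)
  have h3 := legendreCoeff_succ_left (n + 1) (k + 1)
  push_cast at h2 h3
  rw [show n + 2 = n + 1 + 1 by ring] at *
  linear_combination h1 + h3 - h2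

/-- The value at `0` of the Legendre polynomial of degree `n`. -/
def legendreZero (n : ℕ) : ℚ :=
  ∑ k ∈ Finset.range (n + 1), legendreCoeff n k * (-1 / 2) ^ k

/-- The harmonic variant `∑ C(n, k) C(n + k, k) H_k (-1/2)^k` of `legendreZero`. -/
def legendreHarmonic (n : ℕ) : ℚ :=
  ∑ k ∈ Finset.range (n + 1), legendreCoeff n k * (-1 / 2) ^ k * harmonic k

theorem sum_legendreCoeff_mul (n N : ℕ) (h : n + 1 ≤ N) (f : ℕ → ℚ) :
    ∑ k ∈ Finset.range (n + 1), legendreCoeff n k * (-1 / 2) ^ k * f k =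
      ∑ k ∈ Finset.range N, legendreCoeff n k * (-1 / 2) ^ k * f k := by
  refine Finset.sum_subset (Finset.range_mono h) fun k _ hk => ?_
  rw [legendreCoeff_eq_zero (by simpa using hk)]
  simp

/-- Summation by parts against the three-term recurrence. -/
theorem legendre_recurrence_sum (n : ℕ) (f : ℕ → ℚ) :
    ((n : ℚ) + 2) * ∑ k ∈ Finset.range (n + 2 + 1), legendreCoeff (n + 2) k * (-1 / 2) ^ k * f k +
      (n + 1) * ∑ k ∈ Finset.range (n + 1), legendreCoeff n k * (-1 / 2) ^ k * f k =
      (2 * n + 3) * ∑ k ∈ Finset.range (n + 1 + 1),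
        legendreCoeff (n + 1) k * (-1 / 2) ^ k * (f k - f (k + 1)) := by
  rw [sum_legendreCoeff_mul n (n + 2 + 1) (by omega), Finset.mul_sum, Finset.mul_sum,
    ← Finset.sum_add_distrib, Finset.sum_range_succ', Finset.mul_sum]
  -- At `y = -1/2` the factor `1 + 2y` is zero, so after shifting the index only `f k - f (k+1)` and
  -- a telescoping difference survive.
  have h1 : ∀ k, ((n : ℚ) + 2) * (legendreCoeff (n + 2) (k + 1) * (-1 / 2) ^ (k + 1) * f (k + 1)) +
      (n + 1) * (legendreCoeff n (k + 1) * (-1 / 2) ^ (k + 1) * f (k + 1)) =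
      (2 * n + 3) * (legendreCoeff (n + 1) k * (-1 / 2) ^ k * (f k - f (k + 1))) +
      ((2 * n + 3) * legendreCoeff (n + 1) (k + 1) * (-1 / 2) ^ (k + 1) * f (k + 1) -
       (2 * n + 3) * legendreCoeff (n + 1) k * (-1 / 2) ^ k * f k) := by
    intro k
    linear_combination (-1 / 2 : ℚ) ^ (k + 1) * f (k + 1) * legendreCoeff_three_term n k
  rw [Finset.sum_congr rfl fun k _ => h1 k, Finset.sum_add_distrib,
    Finset.sum_range_sub (fun k => (2 * (n : ℚ) + 3) * legendreCoeff (n + 1) k * (-1 / 2) ^ k * f k),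
    legendreCoeff_eq_zero (show n + 1 < n + 2 by omega)]
  simp only [legendreCoeff_zero_right]
  ring

theorem legendreZero_add_two (n : ℕ) :
    ((n : ℚ) + 2) * legendreZero (n + 2) + (n + 1) * legendreZero n = 0 := by
  simpa [legendreZero] using legendre_recurrence_sum n (fun _ => 1)

/-- For `f = harmonic` the difference `f k - f (k+1)` is `-1/(k+1)`, and `legendreCoeff_add_two_sub`
absorbs that denominator. -/
theorem legendreHarmonic_add_two (n : ℕ) :
    ((n : ℚ) + 2) * legendreHarmonic (n + 2) + (n + 1) * legendreHarmonic n =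
      legendreZero (n + 2) - legendreZero n := by
  unfold legendreHarmonic
  rw [legendre_recurrence_sum n harmonic]
  have h1 : legendreZero n = ∑ k ∈ Finset.range (n + 2 + 1), legendreCoeff n k * (-1 / 2) ^ k := by
    simpa [legendreZero] using sum_legendreCoeff_mul n (n + 2 + 1) (by omega) (fun _ => 1)
  rw [h1, legendreZero, ← Finset.sum_sub_distrib, Finset.sum_range_succ' _ (n + 2), Finset.mul_sum]
  simp only [legendreCoeff_zero_right, sub_self, add_zero]
  refine Finset.sum_congr rfl fun k _ => ?_
  have hk : (k : ℚ) + 1 ≠ 0 := by positivity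
  rw [harmonic_succ]
  have h2 := legendreCoeff_add_two_sub n k
  have h3 : (2 * (n : ℚ) + 3) * legendreCoeff (n + 1) k =
      (k + 1) * (legendreCoeff (n + 2) (k + 1) - legendreCoeff n (k + 1)) / 2 := by
    linear_combination -h2 / 2
  push_cast
  rw [show (2 * (n : ℚ) + 3) * (legendreCoeff (n + 1) k * (-1 / 2) ^ k *
    (harmonic k - (harmonic k + ((k : ℚ) + 1)⁻¹))) = -((2 * (n : ℚ) + 3) * legendreCoeff (n + 1) k) *
      (-1 / 2) ^ k * ((k : ℚ) + 1)⁻¹ by ring, h3]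
  field_simp
  ring

theorem legendreZero_odd (m : ℕ) : legendreZero (2 * m + 1) = 0 := by
  induction m with
  | zero => norm_num [legendreZero, Finset.sum_range_succ, legendreCoeff]
  | succ m ih =>
    have h := legendreZero_add_two (2 * m + 1)
    rw [ih, mul_zero, add_zero] at h
    have h2 : ((2 * m + 1 : ℕ) : ℚ) + 2 ≠ 0 := by positivity
    exact (mul_eq_zero.1 h).resolve_left h2

theorem legendreZero_even (m : ℕ) :
    legendreZero (2 * m) * ((-4) ^ m * (m.factorial : ℚ) ^ 2) = (2 * m).factorial := by
  induction m with
  | zero => norm_num [legendreZero, legendreCoeff]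
  | succ m ih =>
    have h := legendreZero_add_two (2 * m)
    have hm : (m : ℚ) + 1 ≠ 0 := by positivity
    rw [show 2 * (m + 1) = 2 * m + 2 by ring, Nat.factorial_succ m, Nat.factorial_succ (2 * m + 1),
      Nat.factorial_succ (2 * m)]
    push_cast at h ⊢
    rw [← ih]
    linear_combination (-4) * (-4) ^ m * (m.factorial : ℚ) ^ 2 * (m + 1) / 2 * h

theorem legendreHarmonic_even (m : ℕ) :
    legendreHarmonic (2 * m) = legendreZero (2 * m) * harmonic (2 * m) := by
  induction m with
  | zero => simp [legendreHarmonic]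
  | succ m ih =>
    have h1 := legendreZero_add_two (2 * m)
    have h2 := legendreHarmonic_add_two (2 * m)
    have hm : ((2 * m : ℕ) : ℚ) + 2 ≠ 0 := by positivity
    have hm' : ((2 * m : ℕ) : ℚ) + 1 ≠ 0 := by positivity
    rw [ih] at h2
    rw [show 2 * (m + 1) = 2 * m + 2 by ring]
    apply mul_left_cancel₀ hm
    rw [harmonic_succ, harmonic_succ]
    have e1 : ((2 * m : ℕ) : ℚ) + 1 = ((2 * m + 1 : ℕ) : ℚ) := by push_cast; ring
    have e2 : ((2 * m : ℕ) : ℚ) + 2 = ((2 * m + 1 + 1 : ℕ) : ℚ) := by push_cast; ring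
    rw [← e1, ← e2]
    generalize ((2 * m : ℕ) : ℚ) = x at *
    have h3 : legendreZero (2 * m) = -(x + 2) * legendreZero (2 * m + 2) / (x + 1) := by
      field_simp
      linear_combination h1
    rw [h3] at h2
    field_simp at h2 ⊢
    linear_combination h2

theorem legendreHarmonic_odd (m : ℕ) :
    legendreHarmonic (2 * m + 1) * (2 * m + 1).factorial = -((-4) ^ m * (m.factorial : ℚ) ^ 2) := by
  induction m with
  | zero => norm_num [legendreHarmonic, Finset.sum_range_succ, legendreCoeff]
  | succ m ih =>
    have h := legendreHarmonic_add_two (2 * m + 1)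
    have h0 := legendreZero_odd (m + 1)
    rw [show 2 * (m + 1) + 1 = 2 * m + 1 + 2 by ring] at *
    rw [legendreZero_odd m, h0] at h
    rw [Nat.factorial_succ m, Nat.factorial_succ (2 * m + 1 + 1),
      Nat.factorial_succ (2 * m + 1)]
    push_cast at h ih ⊢
    linear_combination (2 * (m : ℚ) + 2) * (2 * m + 1).factorial * h - (2 * (m : ℚ) + 2) ^ 2 * ih

/-! ### Expansions of products -/

/-- The second elementary symmetric function `e` is fixed before `x`, so that expansions at two
different `x` can be compared. -/
theorem exists_prod_one_add_mul {R : Type*} [CommRing R] (a : ℕ → R) (k : ℕ) :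
    ∃ e : R, 2 * e = (∑ j ∈ Finset.range k, a j) ^ 2 - ∑ j ∈ Finset.range k, a j ^ 2 ∧
      ∀ x : R, ∃ r : R, ∏ j ∈ Finset.range k, (1 + x * a j) =
        1 + x * ∑ j ∈ Finset.range k, a j + x ^ 2 * e + x ^ 3 * r := by
  induction k with
  | zero => exact ⟨0, by simp, fun x => ⟨0, by simp⟩⟩
  | succ k ih =>
    obtain ⟨e, he, h⟩ := ih
    refine ⟨e + a k * ∑ j ∈ Finset.range k, a j, ?_, fun x => ?_⟩
    · rw [Finset.sum_range_succ, Finset.sum_range_succ]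
      linear_combination he
    · obtain ⟨r, hr⟩ := h x
      refine ⟨r + a k * e + x * a k * r, ?_⟩
      rw [Finset.prod_range_succ, Finset.sum_range_succ, hr]
      ring

theorem prod_range_two_mul {M : Type*} [CommMonoid M] (f : ℕ → M) (m : ℕ) :
    ∏ j ∈ Finset.range (2 * m), f j =
      (∏ i ∈ Finset.range m, f (2 * i)) * ∏ i ∈ Finset.range m, f (2 * i + 1) := by
  induction m with
  | zero => simp
  | succ m ih =>
    rw [show 2 * (m + 1) = 2 * m + 1 + 1 by ring, Finset.prod_range_succ, Finset.prod_range_succ, ih,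
      Finset.prod_range_succ, Finset.prod_range_succ, mul_assoc, mul_mul_mul_comm]

/-! ### Harmonic numbers as `p`-adic integers -/

section
variable {p : ℕ} [Fact p.Prime]

/-- The harmonic numbers as `p`-adic integers, meaningful for `k < p`. -/
noncomputable def padicHarmonic (p : ℕ) [Fact p.Prime] (k : ℕ) : ℤ_[p] :=
  ∑ j ∈ Finset.range k, PadicInt.inv ((j + 1 : ℕ) : ℤ_[p])

theorem natCast_mul_padicInv {k : ℕ} (h0 : k ≠ 0) (hk : k < p) :
    (k : ℤ_[p]) * PadicInt.inv (k : ℤ_[p]) = 1 :=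
  PadicInt.mul_inv (PadicInt.norm_natCast_eq_one_iff.2
    ((Nat.coprime_of_lt_prime h0 hk Fact.out)))

theorem isUnit_natCast_padicInt {k : ℕ} (h0 : k ≠ 0) (hk : k < p) : IsUnit (k : ℤ_[p]) :=
  IsUnit.of_mul_eq_one _ (natCast_mul_padicInv h0 hk)

theorem isUnit_factorial_padicInt {k : ℕ} (hk : k < p) : IsUnit ((k.factorial : ℕ) : ℤ_[p]) := by
  rw [PadicInt.isUnit_iff, PadicInt.norm_natCast_eq_one_iff]
  exact (Nat.Prime.coprime_iff_not_dvd Fact.out).2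
    fun h => absurd ((Nat.Prime.dvd_factorial Fact.out).1 h) (by omega)

theorem padicHarmonic_succ (k : ℕ) :
    padicHarmonic p (k + 1) = padicHarmonic p k + PadicInt.inv ((k + 1 : ℕ) : ℤ_[p]) :=
  Finset.sum_range_succ _ _

theorem coe_padicHarmonic {k : ℕ} (hk : k < p) :
    ((padicHarmonic p k : ℤ_[p]) : ℚ_[p]) = ((harmonic k : ℚ) : ℚ_[p]) := by
  induction k with
  | zero => simp [padicHarmonic]
  | succ k ih =>
    rw [padicHarmonic_succ, harmonic_succ, PadicInt.coe_add, ih (by omega)]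
    have h := congrArg (fun z : ℤ_[p] => (z : ℚ_[p]))
      (natCast_mul_padicInv (p := p) (Nat.succ_ne_zero k) hk)
    simp only [PadicInt.coe_mul, PadicInt.coe_one, PadicInt.coe_natCast] at h
    push_cast at h ⊢
    congr 1
    exact eq_inv_of_mul_eq_one_right h

theorem prod_add_eq_factorial_mul {k : ℕ} (hk : k < p) (x : ℤ_[p]) :
    ∏ j ∈ Finset.range k, (((j + 1 : ℕ) : ℤ_[p]) + x) =
      (k.factorial : ℤ_[p]) *
        ∏ j ∈ Finset.range k, (1 + x * PadicInt.inv ((j + 1 : ℕ) : ℤ_[p])) := by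
  rw [← Finset.prod_range_add_one_eq_factorial, Nat.cast_prod, ← Finset.prod_mul_distrib]
  refine Finset.prod_congr rfl fun j hj => ?_
  have h := natCast_mul_padicInv (p := p) (Nat.succ_ne_zero j)
    (by have := Finset.mem_range.1 hj; omega)
  linear_combination -x * h

/-- First-order expansion of a shifted factorial. -/
theorem exists_prod_add_eq {k : ℕ} (hk : k < p) (x : ℤ_[p]) :
    ∃ r : ℤ_[p], ∏ j ∈ Finset.range k, (((j + 1 : ℕ) : ℤ_[p]) + x) =
      (k.factorial : ℤ_[p]) * (1 + x * padicHarmonic p k + x ^ 2 * r) := by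
  obtain ⟨e, -, h⟩ := exists_prod_one_add_mul (fun j => PadicInt.inv ((j + 1 : ℕ) : ℤ_[p])) k
  obtain ⟨r, hr⟩ := h x
  refine ⟨e + x * r, ?_⟩
  rw [prod_add_eq_factorial_mul hk, hr, padicHarmonic]
  ring

theorem prime_not_dvd_natCast {k : ℕ} (h0 : k ≠ 0) (hk : k < p) : ¬ (p : ℤ_[p]) ∣ (k : ℤ_[p]) :=
  fun h => PadicInt.prime_p.not_isUnit (isUnit_of_dvd_unit h (isUnit_natCast_padicInt h0 hk))

theorem dvd_padicInv_add {j k : ℕ} (hj : j ≠ 0) (hk : k ≠ 0) (h : j + k = p) :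
    (p : ℤ_[p]) ∣ PadicInt.inv (j : ℤ_[p]) + PadicInt.inv (k : ℤ_[p]) := by
  have h1 := natCast_mul_padicInv (p := p) hj (by omega)
  have h2 := natCast_mul_padicInv (p := p) hk (by omega)
  have h3 : (j : ℤ_[p]) + k = (p : ℤ_[p]) := by exact_mod_cast congrArg (Nat.cast : ℕ → ℤ_[p]) h
  refine ⟨PadicInt.inv (j : ℤ_[p]) * PadicInt.inv (k : ℤ_[p]), ?_⟩
  rw [← h3]
  linear_combination -PadicInt.inv (k : ℤ_[p]) * h1 - PadicInt.inv (j : ℤ_[p]) * h2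

/-- Adding the sum to its reflection pairs `1/j` with `1/(p-j)`, whose sum is divisible by `p`. -/
theorem dvd_padicHarmonic_pred (hp : 2 < p) : (p : ℤ_[p]) ∣ padicHarmonic p (p - 1) := by
  have h : (p : ℤ_[p]) ∣ padicHarmonic p (p - 1) + padicHarmonic p (p - 1) := by
    nth_rewrite 2 [padicHarmonic]
    rw [← Finset.sum_range_reflect, padicHarmonic, ← Finset.sum_add_distrib]
    refine Finset.dvd_sum fun j hj => ?_
    have := Finset.mem_range.1 hj
    exact dvd_padicInv_add (by omega) (by omega) (by omega)
  rw [← two_mul] at h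
  refine (PadicInt.prime_p.dvd_or_dvd h).resolve_left ?_
  exact_mod_cast prime_not_dvd_natCast (p := p) two_ne_zero hp

theorem dvd_padicHarmonic_reflect (hp : 2 < p) {k : ℕ} (hk : k < p) :
    (p : ℤ_[p]) ∣ padicHarmonic p (p - 1 - k) - padicHarmonic p k := by
  induction k with
  | zero => simpa [padicHarmonic] using dvd_padicHarmonic_pred (p := p) hp
  | succ k ih =>
    have h1 := ih (by omega)
    have h2 := dvd_padicInv_add (p := p) (j := p - 1 - (k + 1) + 1) (k := k + 1)
      (by omega) (by omega) (by omega)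
    rw [show p - 1 - k = p - 1 - (k + 1) + 1 by omega, padicHarmonic_succ] at h1
    rw [padicHarmonic_succ]
    have := dvd_sub h1 h2
    refine this.trans (dvd_of_eq ?_)
    ring

/-- Multiplication by 2 permutes the residues and scales the sum by `1/4`, so three times the sum
vanishes. The term at `0` is harmless because `0⁻¹ = 0`. -/
theorem sum_inv_sq_zmod (hp : 3 < p) : ∑ x : ZMod p, (x⁻¹) ^ 2 = 0 := by
  have h2 : (2 : ZMod p) ≠ 0 := by
    have : ((2 : ℕ) : ZMod p) ≠ 0 := by
      rw [Ne, ZMod.natCast_eq_zero_iff]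
      exact fun h => absurd (Nat.le_of_dvd (by norm_num) h) (by omega)
    exact_mod_cast this
  have h3 : (3 : ZMod p) ≠ 0 := by
    have : ((3 : ℕ) : ZMod p) ≠ 0 := by
      rw [Ne, ZMod.natCast_eq_zero_iff]
      exact fun h => absurd (Nat.le_of_dvd (by norm_num) h) (by omega)
    exact_mod_cast this
  have h := Fintype.sum_equiv (Equiv.mulLeft₀ (2 : ZMod p) h2) (fun x => ((2 * x)⁻¹) ^ 2)
    (fun x => (x⁻¹) ^ 2) (fun x => rfl)
  simp only [mul_inv, mul_pow] at h
  rw [← Finset.mul_sum] at h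
  have h4 : (3 : ZMod p) * ∑ x : ZMod p, (x⁻¹) ^ 2 = 0 := by
    have h5 : (2 : ZMod p) * 2⁻¹ = 1 := mul_inv_cancel₀ h2
    linear_combination (-4) * h + (2 * 2⁻¹ + 1) * (∑ x : ZMod p, (x⁻¹) ^ 2) * h5
  exact (mul_eq_zero.1 h4).resolve_left h3

theorem toZMod_padicInv {k : ℕ} (h0 : k ≠ 0) (hk : k < p) :
    PadicInt.toZMod (PadicInt.inv (k : ℤ_[p])) = ((k : ZMod p))⁻¹ := by
  have h := congrArg (PadicInt.toZMod (p := p)) (natCast_mul_padicInv (p := p) h0 hk)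
  rw [map_mul, map_natCast, map_one] at h
  exact eq_inv_of_mul_eq_one_right h

theorem sum_zmod_eq_sum_range {M : Type*} [AddCommMonoid M] (f : ZMod p → M) :
    ∑ x : ZMod p, f x = ∑ j ∈ Finset.range p, f (j : ZMod p) := by
  symm
  refine Finset.sum_bij (fun j _ => (j : ZMod p)) (fun _ _ => Finset.mem_univ _) ?_ ?_
    (fun _ _ => rfl)
  · intro a ha b hb hab
    rw [ZMod.natCast_eq_natCast_iff'] at hab
    rwa [Nat.mod_eq_of_lt (Finset.mem_range.1 ha), Nat.mod_eq_of_lt (Finset.mem_range.1 hb)] at hab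
  · intro x _
    exact ⟨x.val, Finset.mem_range.2 (ZMod.val_lt x), ZMod.natCast_zmod_val x⟩

theorem dvd_iff_toZMod_eq_zero (x : ℤ_[p]) : (p : ℤ_[p]) ∣ x ↔ PadicInt.toZMod x = 0 := by
  rw [← RingHom.mem_ker, PadicInt.ker_toZMod, PadicInt.maximalIdeal_eq_span_p,
    Ideal.mem_span_singleton]

/-- The reflection `j ↦ p - j` makes both halves of the full sum of inverse squares equal. -/
theorem dvd_sum_padicInv_sq (hp : 3 < p) {n : ℕ} (hn : p = 2 * n + 1) :
    (p : ℤ_[p]) ∣ ∑ j ∈ Finset.range n, PadicInt.inv ((j + 1 : ℕ) : ℤ_[p]) ^ 2 := by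
  set A := ∑ j ∈ Finset.range n, PadicInt.inv ((j + 1 : ℕ) : ℤ_[p]) ^ 2 with hA
  have h1 := sum_inv_sq_zmod hp
  have h2 : PadicInt.toZMod A = ∑ j ∈ Finset.range n, (((j + 1 : ℕ) : ZMod p)⁻¹) ^ 2 := by
    rw [hA, map_sum]
    refine Finset.sum_congr rfl fun j hj => ?_
    have := Finset.mem_range.1 hj
    rw [map_pow, toZMod_padicInv (by omega) (by omega)]
  have h3 : ∑ j ∈ Finset.range n, (((n + j + 1 : ℕ) : ZMod p)⁻¹) ^ 2 =
      ∑ j ∈ Finset.range n, (((j + 1 : ℕ) : ZMod p)⁻¹) ^ 2 := by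
    rw [← Finset.sum_range_reflect]
    refine Finset.sum_congr rfl fun j hj => ?_
    have hj' := Finset.mem_range.1 hj
    have h4 : ((n + (n - 1 - j) + 1 : ℕ) : ZMod p) = -((j + 1 : ℕ) : ZMod p) := by
      rw [eq_neg_iff_add_eq_zero, ← Nat.cast_add, show n + (n - 1 - j) + 1 + (j + 1) = p by omega,
        ZMod.natCast_self]
    rw [h4, inv_neg, neg_sq]
  have hs : ∑ j ∈ Finset.range p, (((j : ℕ) : ZMod p)⁻¹) ^ 2 =
      ∑ j ∈ Finset.range (n + n), (((j + 1 : ℕ) : ZMod p)⁻¹) ^ 2 := by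
    rw [show Finset.range p = Finset.range (n + n + 1) by congr 1; omega, Finset.sum_range_succ']
    simp
  rw [sum_zmod_eq_sum_range, hs, Finset.sum_range_add, h3, ← h2, ← map_add,
    ← dvd_iff_toZMod_eq_zero, ← two_mul] at h1
  refine (PadicInt.prime_p.dvd_or_dvd h1).resolve_left ?_
  exact_mod_cast prime_not_dvd_natCast (p := p) two_ne_zero (by omega)

end

/-! ### Harmonic numbers at `p/2` and `p/4`, from product identities -/

/-- Both sides are `(2n)!/n!`. -/
theorem two_pow_mul_prod_odd (n : ℕ) :
    2 ^ n * ∏ j ∈ Finset.range n, (2 * j + 1) = ∏ j ∈ Finset.range n, (n + j + 1) := by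
  have h1 := Finset.prod_range_add_one_eq_factorial (2 * n)
  have h2 := h1
  rw [prod_range_two_mul (fun j => j + 1)] at h1
  rw [two_mul, Finset.prod_range_add, Finset.prod_range_add_one_eq_factorial, ← two_mul] at h2
  have h3 : ∏ i ∈ Finset.range n, (2 * i + 1 + 1) = 2 ^ n * n.factorial := by
    rw [← Finset.prod_range_add_one_eq_factorial, ← Finset.card_range n, ← Finset.prod_const,
      Finset.card_range, ← Finset.prod_mul_distrib]
    exact Finset.prod_congr rfl fun i _ => by ring
  rw [h3, ← h2] at h1
  apply Nat.eq_of_mul_eq_mul_left n.factorial_pos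
  rw [← h1]
  ring

theorem prod_range_two_mul_sub_mul_factorial (m N : ℕ) (h : m ≤ N) :
    (∏ i ∈ Finset.range m, (N - i)) * (N - m).factorial = N.factorial := by
  rw [← Nat.descFactorial_eq_prod_range, mul_comm]
  exact Nat.factorial_mul_descFactorial h

section
variable {p : ℕ} [Fact p.Prime]

/-- Reversing the index turns the factors `2j - (2n+1)` into negated odd numbers and `j - (2n+1)`
into `-(n+j)`. Expanding both sides in `p = 2n+1` is what relates `H_n` to `4^n = 1 + p q`. -/
theorem prod_sub_prime_reflect {R : Type*} [CommRing R] (n : ℕ) :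
    (2 : R) ^ n * ∏ j ∈ Finset.range n, (2 * ((j + 1 : ℕ) : R) - ((2 * n + 1 : ℕ) : R)) =
      ∏ j ∈ Finset.range n, (((j + 1 : ℕ) : R) - ((2 * n + 1 : ℕ) : R)) := by
  have h := congrArg (Nat.cast : ℕ → R) (two_pow_mul_prod_odd n)
  rw [← Finset.prod_range_reflect (fun j => 2 * ((j + 1 : ℕ) : R) - ((2 * n + 1 : ℕ) : R)),
    ← Finset.prod_range_reflect (fun j => ((j + 1 : ℕ) : R) - ((2 * n + 1 : ℕ) : R))]
  have h1 : ∀ j ∈ Finset.range n, 2 * ((n - 1 - j + 1 : ℕ) : R) - ((2 * n + 1 : ℕ) : R) =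
      (-1) * ((2 * j + 1 : ℕ) : R) := by
    intro j hj
    have hj' := Finset.mem_range.1 hj
    obtain ⟨d, rfl⟩ : ∃ d, n = j + 1 + d := ⟨n - (j + 1), by omega⟩
    rw [show j + 1 + d - 1 - j + 1 = d + 1 by omega]
    push_cast
    ring
  have h2 : ∀ j ∈ Finset.range n, ((n - 1 - j + 1 : ℕ) : R) - ((2 * n + 1 : ℕ) : R) =
      (-1) * ((n + j + 1 : ℕ) : R) := by
    intro j hj
    have hj' := Finset.mem_range.1 hj
    obtain ⟨d, rfl⟩ : ∃ d, n = j + 1 + d := ⟨n - (j + 1), by omega⟩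
    rw [show j + 1 + d - 1 - j + 1 = d + 1 by omega]
    push_cast
    ring
  rw [Finset.prod_congr rfl h1, Finset.prod_congr rfl h2, Finset.prod_mul_distrib,
    Finset.prod_mul_distrib, ← Nat.cast_prod, ← Nat.cast_prod, ← h]
  push_cast
  ring

theorem prod_two_mul_add {R : Type*} [CommRing R] {u : R} (hu : 2 * u = 1) (k : ℕ) (x : R) :
    ∏ j ∈ Finset.range k, (2 * ((j + 1 : ℕ) : R) - x) =
      2 ^ k * ∏ j ∈ Finset.range k, (((j + 1 : ℕ) : R) + -(x * u)) := by
  rw [← Finset.card_range k, ← Finset.prod_const, Finset.card_range, ← Finset.prod_mul_distrib]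
  refine Finset.prod_congr rfl fun j _ => ?_
  linear_combination x * hu

/-- `H_{(p-1)/2} ≡ -2 q_p(2) + p q_p(2)^2` modulo `p^2`. -/
theorem sq_dvd_padicHarmonic_half (hp : 3 < p) {n : ℕ} (hn : p = 2 * n + 1) {q : ℤ_[p]}
    (hq : (4 : ℤ_[p]) ^ n = 1 + p * q) :
    (p : ℤ_[p]) ^ 2 ∣ padicHarmonic p n + 2 * q - p * q ^ 2 := by
  have hp0 : (p : ℤ_[p]) ≠ 0 := PadicInt.prime_p.ne_zero
  have hu := (inv_two_four p hp).1
  set u : ℤ_[p] := PadicInt.inv 2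
  obtain ⟨e, he, h⟩ := exists_prod_one_add_mul (fun j => PadicInt.inv ((j + 1 : ℕ) : ℤ_[p])) n
  obtain ⟨b, hb⟩ := dvd_sum_padicInv_sq hp hn
  obtain ⟨r, hr⟩ := h (-p)
  obtain ⟨s, hs⟩ := h (-(p * u))
  have hid := prod_sub_prime_reflect (R := ℤ_[p]) n
  rw [← hn, prod_two_mul_add hu] at hid
  simp only [sub_eq_add_neg] at hid
  rw [prod_add_eq_factorial_mul (by omega), prod_add_eq_factorial_mul (by omega), hr, hs] at hid
  rw [hb] at he
  change 2 * e = padicHarmonic p n ^ 2 - _ at he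
  change (2 : ℤ_[p]) ^ n * (2 ^ n * (_ * (1 + -(p * u) * padicHarmonic p n + _ + _))) =
    _ * (1 + -p * padicHarmonic p n + _ + _) at hid
  have h4 : (4 : ℤ_[p]) ^ n = 2 ^ n * 2 ^ n := by rw [← mul_pow]; norm_num
  have hf := (isUnit_factorial_padicInt (p := p) (k := n) (by omega)).mul_left_cancel
    (show (n.factorial : ℤ_[p]) * ((1 + p * q) * (1 + -(p * u) * padicHarmonic p n +
      (-(p * u)) ^ 2 * e + (-(p * u)) ^ 3 * s)) = (n.factorial : ℤ_[p]) *
      (1 + -p * padicHarmonic p n + (-p) ^ 2 * e + (-p) ^ 3 * r) by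
        rw [← hq, h4]; linear_combination hid)
  generalize padicHarmonic p n = H at *
  -- The factor 8 clears the powers of `u = 1/2` up to the cubic term.
  have hH : (p : ℤ_[p]) * (8 * q + 4 * H - 4 * p * q * H - 6 * p * e + p ^ 2 * (2 * q * e - s
      - p * q * s + 8 * r)) = 0 := by
    have hu2 : u ^ 2 * 4 = 1 := by linear_combination (2 * u + 1) * hu
    have hu3 : u ^ 3 * 8 = 1 := by linear_combination (4 * u ^ 2 + 2 * u + 1) * hu
    linear_combination 8 * hf + 4 * (1 + p * q) * p * H * hu - 2 * (1 + p * q) * p ^ 2 * e * hu2 +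
      (1 + p * q) * p ^ 3 * s * hu3
  have hH2 := (mul_eq_zero.1 hH).resolve_left hp0
  have hq4 : H + 2 * q = p * (u ^ 2 * (4 * q * H + 6 * e - p * (2 * q * e - s
      - p * q * s + 8 * r))) := by
    linear_combination u ^ 2 * hH2 - (H + 2 * q) * (2 * u + 1) * hu
  -- Bootstrapping: `H ≡ -2q` modulo `p` is substituted into the terms `qH` and `e`, which already
  -- carry a factor `p`; there `2e ≡ H²` modulo `p`.
  obtain ⟨c, hc⟩ : (p : ℤ_[p]) ∣ H + 2 * q := ⟨_, hq4⟩
  have hH3 : H = p * c - 2 * q := by linear_combination hc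
  refine ⟨u ^ 2 * (3 * c * (p * c - 2 * q) - 6 * q * c + 4 * q * c - 3 * b -
    (2 * q * e - s - p * q * s + 8 * r)), ?_⟩
  subst hH3
  linear_combination u ^ 2 * hH2 - (p * c - p * q ^ 2) * (2 * u + 1) * hu
    + 3 * p * u ^ 2 * he

/-- With `p = 4m+1`, an odd `j = 2i+1` gives `j - p = -2(2m-i)`, hence `(-2)^m (2m)!/m!` altogether;
an even `j` gives twice a factor shifted by `p/2`. -/
theorem prod_sub_prime_even_odd {R : Type*} [CommRing R] {u : R} (hu : 2 * u = 1) (m : ℕ) :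
    ((m.factorial : ℕ) : R) *
      ∏ j ∈ Finset.range (2 * m), (((j + 1 : ℕ) : R) + -((4 * m + 1 : ℕ) : R)) =
      (-4) ^ m * ((2 * m).factorial : R) *
        ∏ j ∈ Finset.range m, (((j + 1 : ℕ) : R) + -(((4 * m + 1 : ℕ) : R) * u)) := by
  have h0 := congrArg (Nat.cast : ℕ → R)
    (prod_range_two_mul_sub_mul_factorial m (2 * m) (by omega))
  rw [show 2 * m - m = m by omega] at h0
  have h2 := prod_two_mul_add hu m ((4 * m + 1 : ℕ) : R)
  have h1 : ∏ i ∈ Finset.range m, (((2 * i + 1 : ℕ) : R) + -((4 * m + 1 : ℕ) : R)) =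
      (-2) ^ m * ∏ i ∈ Finset.range m, ((2 * m - i : ℕ) : R) := by
    rw [← Finset.card_range m, ← Finset.prod_const, Finset.card_range, ← Finset.prod_mul_distrib]
    refine Finset.prod_congr rfl fun i hi => ?_
    have := Finset.mem_range.1 hi
    rw [Nat.cast_sub (by omega)]
    push_cast
    ring
  rw [prod_range_two_mul, h1, ← Nat.cast_prod,
    Finset.prod_congr rfl (g := fun j : ℕ => 2 * ((j + 1 : ℕ) : R) - ((4 * m + 1 : ℕ) : R))
      (fun i _ => by push_cast; ring), h2, ← h0, show (-4 : R) = (-2) * 2 by norm_num, mul_pow]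
  push_cast
  ring

/-- The analogue for `p = 4m+3`: there are now `m+1` odd indices and `m` even ones, hence the extra
factor `-2`. -/
theorem prod_sub_prime_even_odd' {R : Type*} [CommRing R] {u : R} (hu : 2 * u = 1) (m : ℕ) :
    ((m.factorial : ℕ) : R) *
      ∏ j ∈ Finset.range (2 * m + 1), (((j + 1 : ℕ) : R) + -((4 * m + 3 : ℕ) : R)) =
      -2 * (-4) ^ m * ((2 * m + 1).factorial : R) *
        ∏ j ∈ Finset.range m, (((j + 1 : ℕ) : R) + -(((4 * m + 3 : ℕ) : R) * u)) := by
  have h0 := congrArg (Nat.cast : ℕ → R)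
    (prod_range_two_mul_sub_mul_factorial (m + 1) (2 * m + 1) (by omega))
  rw [show 2 * m + 1 - (m + 1) = m by omega] at h0
  have h2 := prod_two_mul_add hu m ((4 * m + 3 : ℕ) : R)
  have h1 : ∏ i ∈ Finset.range (m + 1), (((2 * i + 1 : ℕ) : R) + -((4 * m + 3 : ℕ) : R)) =
      (-2) ^ (m + 1) * ∏ i ∈ Finset.range (m + 1), ((2 * m + 1 - i : ℕ) : R) := by
    rw [← Finset.card_range (m + 1), ← Finset.prod_const, Finset.card_range,
      ← Finset.prod_mul_distrib]
    refine Finset.prod_congr rfl fun i hi => ?_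
    have := Finset.mem_range.1 hi
    rw [Nat.cast_sub (by omega)]
    push_cast
    ring
  rw [Finset.prod_range_succ, prod_range_two_mul, mul_right_comm,
    ← Finset.prod_range_succ (fun i : ℕ => ((2 * i + 1 : ℕ) : R) + -((4 * m + 3 : ℕ) : R)), h1,
    ← Nat.cast_prod,
    Finset.prod_congr rfl (g := fun j : ℕ => 2 * ((j + 1 : ℕ) : R) - ((4 * m + 3 : ℕ) : R))
      (fun i _ => by push_cast; ring), h2, ← h0, show (-4 : R) = (-2) * 2 by norm_num, mul_pow]
  push_cast
  ring

theorem exists_one_sub_harmonic_eq {n m : ℕ} (hn : n < p) (hm : m < p) {s u : ℤ_[p]}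
    (h : ((m.factorial : ℕ) : ℤ_[p]) * ∏ j ∈ Finset.range n, (((j + 1 : ℕ) : ℤ_[p]) + -p) =
      s * (n.factorial : ℤ_[p]) * ∏ j ∈ Finset.range m, (((j + 1 : ℕ) : ℤ_[p]) + -(p * u))) :
    ∃ r : ℤ_[p], 1 - p * padicHarmonic p n = s * (1 - p * u * padicHarmonic p m) + p ^ 2 * r := by
  obtain ⟨a, ha⟩ := exists_prod_add_eq hn (-(p : ℤ_[p]))
  obtain ⟨b, hb⟩ := exists_prod_add_eq hm (-((p : ℤ_[p]) * u))
  rw [ha, hb] at h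
  have hf := ((isUnit_factorial_padicInt hm).mul (isUnit_factorial_padicInt hn)).mul_left_cancel
    (show _ * (1 + -(p : ℤ_[p]) * padicHarmonic p n + (-p) ^ 2 * a) =
      _ * (s * (1 + -((p : ℤ_[p]) * u) * padicHarmonic p m + (-(p * u)) ^ 2 * b)) by
        linear_combination h)
  exact ⟨s * u ^ 2 * b - a, by linear_combination hf⟩

/-- `2 H_m ≡ 3 H_n` modulo `p` for `n = (p - 1) / 2` and `m = ⌊p / 4⌋`. -/
theorem dvd_two_mul_padicHarmonic_sub (hp : 3 < p) {n m : ℕ} (hn : p = 2 * n + 1) {q s r : ℤ_[p]}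
    (hq : (4 : ℤ_[p]) ^ n = 1 + p * q) (hs : s ^ 2 = 4 ^ n)
    (h : 1 - (p : ℤ_[p]) * padicHarmonic p n =
      s * (1 - (p : ℤ_[p]) * PadicInt.inv 2 * padicHarmonic p m) + (p : ℤ_[p]) ^ 2 * r) :
    (p : ℤ_[p]) ∣ 2 * padicHarmonic p m - 3 * padicHarmonic p n := by
  have hp0 : (p : ℤ_[p]) ≠ 0 := PadicInt.prime_p.ne_zero
  have hu := (inv_two_four p hp).1
  set u : ℤ_[p] := PadicInt.inv 2
  obtain ⟨c, hc⟩ := sq_dvd_padicHarmonic_half hp hn hq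
  rw [hq] at hs
  generalize padicHarmonic p n = H at *
  generalize padicHarmonic p m = G at *
  -- Squaring `h` brings in `s² = 1 + p q`, so `G ≡ q + 2H` modulo `p`; then `hc` replaces `2q` by
  -- `-H`.
  have h2 : (p : ℤ_[p]) * (q - G + 2 * H + p * (-(q * G) + u ^ 2 * G ^ 2 * (1 + p * q) - H ^ 2
      + 2 * r * s * (1 - p * u * G) + p ^ 2 * r ^ 2)) = 0 := by
    linear_combination (-(1 - p * H) - s * (1 - p * u * G) - p ^ 2 * r) * h
      - (1 - p * u * G) ^ 2 * hs + (1 + p * q) * p * G * hu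
  have h3 := (mul_eq_zero.1 h2).resolve_left hp0
  refine ⟨p * c + q ^ 2 + 2 * (-(q * G) + u ^ 2 * G ^ 2 * (1 + p * q) - H ^ 2
      + 2 * r * s * (1 - p * u * G) + p ^ 2 * r ^ 2), ?_⟩
  linear_combination (-2) * h3 + hc

end

/-! ### Morita's Gamma function modulo `p²` -/

/-- The product of the integers below `N` that are coprime to `p`. -/
def coprimeProd (p N : ℕ) : ℕ := ∏ k ∈ (Finset.range N).filter (fun k => Nat.Coprime k p), k

theorem moritaSeq_eq_coprimeProd (p N : ℕ) : moritaSeq p N = (-1) ^ N * (coprimeProd p N : ℤ) := by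
  simp [moritaSeq, coprimeProd]

section
variable {p : ℕ} [Fact p.Prime]

theorem toZModPow_eq_iff_dvd {N : ℕ} {x y : ℤ_[p]} :
    PadicInt.toZModPow N x = PadicInt.toZModPow N y ↔ (p : ℤ_[p]) ^ N ∣ x - y := by
  rw [← sub_eq_zero, ← map_sub, ← RingHom.mem_ker, PadicInt.ker_toZModPow,
    Ideal.mem_span_singleton]

theorem toZModPow_prime_pow (N : ℕ) : PadicInt.toZModPow N ((p : ℤ_[p]) ^ N) = 0 := by
  rw [← map_zero (PadicInt.toZModPow (p := p) N), toZModPow_eq_iff_dvd, sub_zero]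

theorem padicModEq_coe_iff {N : ℕ} {x y : ℤ_[p]} :
    PadicModEq p N x y ↔ PadicInt.toZModPow N x = PadicInt.toZModPow N y := by
  rw [toZModPow_eq_iff_dvd]
  constructor
  · rintro ⟨z, hz⟩
    exact ⟨z, PadicInt.ext (by push_cast; exact hz)⟩
  · rintro ⟨z, hz⟩
    refine ⟨z, ?_⟩
    have := congrArg (fun w : ℤ_[p] => (w : ℚ_[p])) hz
    push_cast at this
    exact this

theorem coprime_mul_add_iff (t a : ℕ) : Nat.Coprime (p * t + a) p ↔ ¬ p ∣ a := by
  rw [add_comm, Nat.coprime_add_mul_left_left, Nat.coprime_comm,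
    Nat.Prime.coprime_iff_not_dvd Fact.out]

/-- The product stops strictly below its argument, so `p * t + 1` ends just after a multiple of `p`;
the next `a < p` integers are all prime to `p`. -/
theorem coprimeProd_mul_add (t : ℕ) {a : ℕ} (ha : a < p) :
    coprimeProd p (p * t + 1 + a) =
      coprimeProd p (p * t + 1) * ∏ j ∈ Finset.range a, (j + 1 + p * t) := by
  unfold coprimeProd
  rw [Finset.prod_filter, Finset.prod_filter, Finset.prod_range_add]
  congr 1
  refine Finset.prod_congr rfl fun j hj => ?_
  have hj' := Finset.mem_range.1 hj
  rw [if_pos]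
  · ring
  · rw [add_assoc, coprime_mul_add_iff]
    exact fun h => absurd (Nat.le_of_dvd (by omega) h) (by omega)

theorem coprimeProd_mul_succ (t : ℕ) :
    coprimeProd p (p * (t + 1) + 1) = coprimeProd p (p * t + 1 + (p - 1)) := by
  have hp : 0 < p := (Fact.out : p.Prime).pos
  have h : p * t + 1 + (p - 1) = p * (t + 1) := by rw [mul_add]; omega
  rw [h]
  unfold coprimeProd
  rw [Finset.prod_filter, Finset.prod_filter, Finset.prod_range_succ, if_neg, mul_one]
  have := coprime_mul_add_iff (p := p) (t + 1) 0
  simp only [add_zero, dvd_zero, not_true, iff_false] at this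
  exact this

theorem toZModPow_coprimeProd_mul_add (t : ℕ) {a : ℕ} (ha : a < p) :
    (coprimeProd p (p * t + 1 + a) : ZMod (p ^ 2)) =
      PadicInt.toZModPow 2 ((coprimeProd p (p * t + 1) : ℤ_[p]) * ((a.factorial : ℤ_[p]) *
        (1 + (p : ℤ_[p]) * (t : ℤ_[p]) * padicHarmonic p a))) := by
  obtain ⟨r, hr⟩ := exists_prod_add_eq ha ((p : ℤ_[p]) * t)
  rw [← map_natCast (PadicInt.toZModPow (p := p) 2), toZModPow_eq_iff_dvd,
    coprimeProd_mul_add t ha]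
  push_cast at hr ⊢
  rw [hr]
  exact ⟨(coprimeProd p (p * t + 1) : ℤ_[p]) * a.factorial * t ^ 2 * r, by ring⟩

/-- A full block is `(p-1)! (1 + p t H_{p-1})` modulo `p²`, and `p ∣ H_{p-1}` removes the
correction. -/
theorem coprimeProd_mul_add_one (hp : 2 < p) (t : ℕ) :
    (coprimeProd p (p * t + 1) : ZMod (p ^ 2)) = ((p - 1).factorial : ZMod (p ^ 2)) ^ t := by
  induction t with
  | zero =>
    simp [coprimeProd, Finset.prod_filter, (Fact.out : p.Prime).ne_one]
  | succ t ih =>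
    obtain ⟨c, hc⟩ := dvd_padicHarmonic_pred (p := p) hp
    rw [coprimeProd_mul_succ, toZModPow_coprimeProd_mul_add t (by omega), hc, map_mul, map_natCast,
      ih, pow_succ _ t, show ((p - 1).factorial : ℤ_[p]) * (1 + (p : ℤ_[p]) * t * (p * c)) =
      (p - 1).factorial * (1 + (p : ℤ_[p]) ^ 2 * (t * c)) by ring, map_mul, map_add,
      map_mul _ ((p : ℤ_[p]) ^ 2),
      toZModPow_prime_pow]
    simp

theorem moritaSeq_mul_add (hp : 2 < p) (t : ℕ) {a : ℕ} (ha : a < p) :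
    ((moritaSeq p (p * t + 1 + a) : ℤ) : ZMod (p ^ 2)) =
      (-1) ^ (p * t + 1 + a) * ((p - 1).factorial : ZMod (p ^ 2)) ^ t * a.factorial *
        (1 + p * t * PadicInt.toZModPow 2 (padicHarmonic p a)) := by
  rw [moritaSeq_eq_coprimeProd]
  push_cast
  rw [toZModPow_coprimeProd_mul_add t ha, ← coprimeProd_mul_add_one hp]
  simp only [map_mul, map_add, map_one, map_natCast]
  ring

/-- The natural number `p * t + 1 + a` inverts `d` modulo `p²`, so it can replace `x = 1/d` in
`Γ_p`. -/
theorem toZModPow_padicGamma_inv (hp : 2 < p) {d t a : ℕ} {x : ℤ_[p]} (hx : (d : ℤ_[p]) * x = 1)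
    (ha : a < p) {c : ℕ} (h : d * (p * t + 1 + a) = c * p ^ 2 + 1) :
    PadicInt.toZModPow 2 (padicGamma p x) =
      (-1) ^ (p * t + 1 + a) * ((p - 1).factorial : ZMod (p ^ 2)) ^ t * a.factorial *
        (1 + p * t * PadicInt.toZModPow 2 (padicHarmonic p a)) := by
  rw [← moritaSeq_mul_add hp t ha]
  refine toZModPow_padicGamma_aux p (by omega) 2 two_ne_zero x _ ?_
  have h1 := congrArg (PadicInt.toZModPow (p := p) 2) hx
  have h2 := congrArg (Nat.cast : ℕ → ZMod (p ^ 2)) h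
  rw [map_mul, map_natCast, map_one] at h1
  have h3 : (p : ZMod (p ^ 2)) ^ 2 = 0 := by exact_mod_cast ZMod.natCast_self (p ^ 2)
  rw [Nat.cast_mul, Nat.cast_add (c * p ^ 2), Nat.cast_mul c, Nat.cast_pow, h3, mul_zero, zero_add,
    Nat.cast_one] at h2
  linear_combination ((p * t + 1 + a : ℕ) : ZMod (p ^ 2)) * h1 - PadicInt.toZModPow 2 x * h2

/-- Wilson's theorem, lifted from `p` to `p²` by taking `p`-th powers. -/
theorem factorial_pred_pow_prime (hp : 2 < p) :
    ((p - 1).factorial : ZMod (p ^ 2)) ^ p = -1 := by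
  have h1 : (p : ℤ_[p]) ∣ ((p - 1).factorial : ℤ_[p]) - (-1) := by
    rw [dvd_iff_toZMod_eq_zero, map_sub, map_natCast, ZMod.wilsons_lemma]
    simp
  have h2 := dvd_sub_pow_of_dvd_sub h1 1
  rw [pow_one, ← toZModPow_eq_iff_dvd, map_pow, map_pow, map_natCast, map_neg, map_one,
    ((Fact.out : p.Prime).odd_of_ne_two (by omega)).neg_one_pow] at h2
  exact h2

theorem factorial_pred_eq {a b : ℕ} (h : a + b + 1 = p) :
    ((p - 1).factorial : ZMod (p ^ 2)) = a.factorial * (-1) ^ b * b.factorial *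
      (1 - p * PadicInt.toZModPow 2 (padicHarmonic p b)) := by
  obtain ⟨r, hr⟩ := exists_prod_add_eq (p := p) (k := b) (by omega) (-(p : ℤ_[p]))
  have h1 : ((p - 1).factorial : ℤ_[p]) = a.factorial * ((-1) ^ b *
      ∏ j ∈ Finset.range b, (((j + 1 : ℕ) : ℤ_[p]) + -p)) := by
    rw [← Finset.prod_range_add_one_eq_factorial, show p - 1 = a + b by omega,
      Finset.prod_range_add, Finset.prod_range_add_one_eq_factorial, ← Finset.prod_range_reflect]
    rw [← Finset.card_range b, ← Finset.prod_const, Finset.card_range, ← Finset.prod_mul_distrib]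
    push_cast
    congr 1
    refine Finset.prod_congr rfl fun j hj => ?_
    obtain ⟨d, rfl⟩ : ∃ d, b = j + 1 + d := ⟨b - (j + 1), by have := Finset.mem_range.1 hj; omega⟩
    rw [show j + 1 + d - 1 - j = d by omega]
    have h2 := congrArg (Nat.cast : ℕ → ℤ_[p]) h
    push_cast at h2
    linear_combination h2
  rw [← map_natCast (PadicInt.toZModPow (p := p) 2), h1, hr,
    show (1 + -(p : ℤ_[p]) * padicHarmonic p b + (-p) ^ 2 * r) =
      1 - p * padicHarmonic p b + p ^ 2 * r by ring]
  simp only [map_mul, map_add, map_sub, map_pow _ (-1 : ℤ_[p]), map_neg, map_one, map_natCast,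
    toZModPow_prime_pow]
  ring

/-! ### Squares of central binomials against Legendre coefficients -/

/-- The factors pair up symmetrically: `4(n+1+j)(n-j) = (2n+1)² - (2j+1)²`. -/
theorem descFactorial_mul_neg_four_pow (n k : ℕ) :
    ((n + k).descFactorial (2 * k) : ℤ) * (-4) ^ k =
      ∏ j ∈ Finset.range k, ((2 * (j : ℤ) + 1) ^ 2 - (2 * n + 1) ^ 2) := by
  induction k with
  | zero => simp
  | succ k ih =>
    rw [Finset.prod_range_succ, ← ih, show n + (k + 1) = n + k + 1 by ring,
      show 2 * (k + 1) = 2 * k + 1 + 1 by ring, Nat.succ_descFactorial_succ, Nat.descFactorial_succ,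
      show n + k - 2 * k = n - k by omega]
    rcases le_or_gt k n with h | h
    · push_cast [Nat.cast_sub h]
      ring
    · rw [Nat.descFactorial_of_lt (show n + k < 2 * k by omega)]
      simp

theorem prod_odd_mul (k : ℕ) :
    (∏ j ∈ Finset.range k, (2 * j + 1)) * (2 ^ k * k.factorial) = (2 * k).factorial := by
  rw [← mul_assoc, mul_comm _ (2 ^ k), two_pow_mul_prod_odd, two_mul,
    ← Finset.prod_range_add_one_eq_factorial (k + k), Finset.prod_range_add,
    Finset.prod_range_add_one_eq_factorial, mul_comm]

/-- Dropping `(2n+1)² = p²` from the paired factors leaves the squares of the odd numbers, that is,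
`((2k)!/(2^k k!))²`. -/
theorem choose_two_mul_sq_modEq {n k : ℕ} (hn : p = 2 * n + 1) (hk : k < p) :
    (p : ℤ_[p]) ^ 2 ∣ ((2 * k).choose k : ℤ_[p]) ^ 2 -
      (n + k).choose (2 * k) * (2 * k).choose k * (-16) ^ k := by
  have hC : ((2 * k).choose k : ℤ_[p]) * k.factorial * k.factorial = (2 * k).factorial := by
    have := Nat.choose_mul_factorial_mul_factorial (show k ≤ 2 * k by omega)
    rw [show 2 * k - k = k by omega] at this
    exact_mod_cast congrArg (Nat.cast : ℕ → ℤ_[p]) this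
  have hku := isUnit_factorial_padicInt (p := p) hk
  rcases le_or_gt k n with h | h
  · have h1 := congrArg (Int.cast : ℤ → ZMod (p ^ 2)) (descFactorial_mul_neg_four_pow n k)
    have h2 := congrArg (Nat.cast : ℕ → ZMod (p ^ 2)) (prod_odd_mul k)
    have h3 : (p : ZMod (p ^ 2)) ^ 2 = 0 := by exact_mod_cast ZMod.natCast_self (p ^ 2)
    have h4 : 2 * (n : ZMod (p ^ 2)) + 1 = p := by
      have := congrArg (Nat.cast : ℕ → ZMod (p ^ 2)) hn
      push_cast at this
      exact this.symm
    rw [Nat.descFactorial_eq_factorial_mul_choose] at h1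
    push_cast at h1 h2
    rw [h4, h3] at h1
    simp only [sub_zero, Finset.prod_pow] at h1
    have hC' := congrArg (PadicInt.toZModPow (p := p) 2) hC
    simp only [map_mul, map_natCast] at hC'
    have h2u := (isUnit_factorial_padicInt (p := p) (k := 2 * k) (by omega)).map
      (PadicInt.toZModPow (p := p) 2)
    have hku' := hku.map (PadicInt.toZModPow (p := p) 2)
    rw [map_natCast] at h2u hku'
    rw [← toZModPow_eq_iff_dvd]
    simp only [map_mul, map_pow, map_natCast, map_neg, map_ofNat]
    apply (h2u.mul (hku'.pow 2)).mul_left_cancel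
    have h16 : (-16 : ZMod (p ^ 2)) ^ k = (-4) ^ k * (2 ^ k) ^ 2 := by
      rw [← pow_mul, mul_comm k 2, pow_mul, ← mul_pow]
      norm_num
    rw [h16]
    linear_combination ((2 * k).factorial : ZMod (p ^ 2)) * (2 * k).choose k * hC'
      - ((2 * k).choose k : ZMod (p ^ 2)) * (2 ^ k) ^ 2 * (k.factorial : ZMod (p ^ 2)) ^ 2 * h1
      - ((2 * k).choose k : ZMod (p ^ 2)) * ((∏ j ∈ Finset.range k, (2 * (j : ZMod (p ^ 2)) + 1)) *
        (2 ^ k * (k.factorial : ZMod (p ^ 2))) + (2 * k).factorial) * h2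
  -- For `n < k < p` the Legendre coefficient is zero and `p` divides `C(2k,k)`, so both sides
  -- vanish.
  · rw [Nat.choose_eq_zero_of_lt (show n + k < 2 * k by omega)]
    have h1 : (p : ℤ_[p]) ∣ (2 * k).factorial :=
      Nat.cast_dvd_cast (Nat.dvd_factorial (by omega) (by omega))
    rw [← hC] at h1
    have h2 := (hku.dvd_mul_right.1 (hku.dvd_mul_right.1 h1))
    simpa using pow_dvd_pow_of_dvd h2 2

end

/-! ### First-order bookkeeping modulo `p²` -/

theorem one_add_mul_one_add_of_sq_eq_zero {R : Type*} [CommRing R] {k : R} (hk : k ^ 2 = 0)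
    (a b : R) : (1 + a * k) * (1 + b * k) = 1 + (a + b) * k := by
  linear_combination a * b * hk

/-- Here `e` plays `p`, `W` is `(p-1)!`, `Fᵢ` and `hᵢ` are the factorial and harmonic number at `i *
m`, and `s = (-4)^m`. Every correction is `1 + a k` with `k = p H_{2m}` and `k² = 0`, so only the
sum of the coefficients `a` matters. -/
theorem gamma_product_even {R : Type*} [CommRing R] {e m u s W Y Z F₁ F₂ F₃ h₁ h₂ h₃ : R}
    (he : e ^ 2 = 0) (hem : e = 4 * m + 1) (hu : 2 * u = 1) (hY : Y ^ 4 * W ^ 2 = 1)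
    (hZ : Z ^ 2 = Y ^ 3) (hW : W ^ 2 = F₃ ^ 2 * F₁ ^ 2 * (1 - e * h₁) ^ 2)
    (hs : 1 - e * h₂ = s * (1 - e * u * h₁))
    (h₃₁ : e * h₃ = e * h₁) (h₁₂ : 2 * (e * h₁) = 3 * (e * h₂)) :
    s * F₁ ^ 2 * (Y * F₂ * (1 + e * (2 * m) * h₂) * (Z * F₃ * (1 + e * (3 * m) * h₃)) ^ 2) =
      F₂ := by
  -- From `4m = e - 1` and `e² = 0`: `e m = -e/4`.
  have hm : e * m = -(u ^ 2 * e) := by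
    linear_combination u ^ 2 * he - e * u ^ 2 * hem - e * m * (2 * u + 1) * hu
  have hk : e * h₁ = 3 * u * (e * h₂) := by linear_combination u * h₁₂ - e * h₁ * hu
  set k := e * h₂ with hkd
  have hk2 : k ^ 2 = 0 := by rw [hkd, mul_pow, he, zero_mul]
  have hmul := one_add_mul_one_add_of_sq_eq_zero hk2
  have hs' : s = 1 + (3 * u ^ 2 - 1) * k := by
    have h1 : 1 + (-1) * k = s * (1 + (-3 * u ^ 2) * k) := by
      linear_combination hs - s * u * hk
    have h2 := hmul (-3 * u ^ 2) (3 * u ^ 2)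
    have h3 := hmul (-1) (3 * u ^ 2)
    linear_combination h3 - s * h2 - (1 + 3 * u ^ 2 * k) * h1
  have hF : F₃ ^ 2 * F₁ ^ 2 = W ^ 2 * (1 + 3 * k) := by
    have h1 : W ^ 2 = F₃ ^ 2 * F₁ ^ 2 * ((1 + (-3 * u) * k) * (1 + (-3 * u) * k)) := by
      rw [hW, hk]; ring
    rw [h1, hmul, mul_assoc, hmul]
    linear_combination (3 * k * F₃ ^ 2 * F₁ ^ 2) * hu
  have h2' : 1 + e * (2 * m) * h₂ = 1 + (-u) * k := by
    linear_combination 2 * h₂ * hm - u * k * hu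
  have h3' : 1 + e * (3 * m) * h₃ = 1 + (-9 * u ^ 3) * k := by
    linear_combination 3 * h₃ * hm - 3 * u ^ 2 * h₃₁ - 3 * u ^ 2 * hk
  calc _ = F₂ * Y * Z ^ 2 * (F₃ ^ 2 * F₁ ^ 2) * (s * (1 + e * (2 * m) * h₂) *
      ((1 + e * (3 * m) * h₃) * (1 + e * (3 * m) * h₃))) := by ring
    _ = F₂ * (Y ^ 4 * W ^ 2) * ((1 + 3 * k) * ((1 + (3 * u ^ 2 - 1) * k) * (1 + (-u) * k) *
        ((1 + (-9 * u ^ 3) * k) * (1 + (-9 * u ^ 3) * k)))) := by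
      rw [hZ, hF, hs', h2', h3']; ring
    _ = F₂ := by
      rw [hmul, hmul, hmul, hmul, hY]
      -- The total coefficient `3 + (3u² - 1) - u - 18u³` vanishes at `u = 1/2`.
      linear_combination -F₂ * k * (9 * u ^ 2 + 3 * u + 2) * hu

/-- Same bookkeeping for `p = 4m+3`, with `F₁ = m!`, `F₂ = (2m+1)!` and `s = -2(-4)^m`. The
coefficients now total `-1/4`, which is the first-order part of `s` itself. -/
theorem gamma_product_odd {R : Type*} [CommRing R] {e m u s W Y Z F₁ F₂ h₁ h₂ : R}
    (he : e ^ 2 = 0) (hem : e = 4 * m + 3) (hu : 2 * u = 1) (hY : Y * Z ^ 2 * W = 1)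
    (hW : W = -(F₂ * F₂ * (1 - e * h₂))) (hs : 1 - e * h₂ = s * (1 - e * u * h₁))
    (h₁₂ : 2 * (e * h₁) = 3 * (e * h₂)) :
    F₂ * (-(Y * F₂ * (1 + e * (2 * m + 1) * h₂)) * (Z * F₁ * (1 + e * (3 * m + 2) * h₁)) ^ 2) =
      s * F₁ ^ 2 := by
  have hm : e * m = -(3 * u ^ 2 * e) := by
    linear_combination u ^ 2 * he - e * u ^ 2 * hem - e * m * (2 * u + 1) * hu
  have hk : e * h₁ = 3 * u * (e * h₂) := by linear_combination u * h₁₂ - e * h₁ * hu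
  set k := e * h₂ with hkd
  have hk2 : k ^ 2 = 0 := by rw [hkd, mul_pow, he, zero_mul]
  have hmul := one_add_mul_one_add_of_sq_eq_zero hk2
  have hs' : s = 1 + (3 * u ^ 2 - 1) * k := by
    have h1 : 1 + (-1) * k = s * (1 + (-3 * u ^ 2) * k) := by
      linear_combination hs - s * u * hk
    have h2 := hmul (-3 * u ^ 2) (3 * u ^ 2)
    have h3 := hmul (-1) (3 * u ^ 2)
    linear_combination h3 - s * h2 - (1 + 3 * u ^ 2 * k) * h1
  have hF : -(F₂ * F₂) = W * (1 + 1 * k) := by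
    have h1 : W = -(F₂ * F₂) * (1 + (-1) * k) := by rw [hW]; ring
    rw [h1, mul_assoc, hmul]
    ring
  have h2' : 1 + e * (2 * m + 1) * h₂ = 1 + (-u) * k := by
    linear_combination 2 * h₂ * hm - (3 * u + 1) * k * hu
  have h3' : 1 + e * (3 * m + 2) * h₁ = 1 + (3 * u * (2 - 9 * u ^ 2)) * k := by
    linear_combination 3 * h₁ * hm + (2 - 9 * u ^ 2) * hk
  calc _ = F₁ ^ 2 * (Y * Z ^ 2) * (-(F₂ * F₂)) * ((1 + e * (2 * m + 1) * h₂) *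
      ((1 + e * (3 * m + 2) * h₁) * (1 + e * (3 * m + 2) * h₁))) := by ring
    _ = F₁ ^ 2 * (Y * Z ^ 2 * W) * ((1 + 1 * k) * ((1 + (-u) * k) *
        ((1 + (3 * u * (2 - 9 * u ^ 2)) * k) * (1 + (3 * u * (2 - 9 * u ^ 2)) * k)))) := by
      rw [hF, h2', h3']; ring
    _ = s * F₁ ^ 2 := by
      rw [hmul, hmul, hmul, hY, hs']
      linear_combination F₁ ^ 2 * k * (-27 * u ^ 2 - 15 * u - 2) * hu

/-! ### Reduction of the sum and comparison with the Gamma values -/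

section
variable {p : ℕ} [Fact p.Prime]

theorem exists_padicInt_sums (hp : 3 < p) {n : ℕ} (hn : p = 2 * n + 1) :
    ∃ A B : ℤ_[p],
      (A : ℚ_[p]) = ((∑ k ∈ Finset.range p,
        ((2 * k).choose k : ℚ) ^ 2 * (harmonic k / (32 : ℚ) ^ k) : ℚ) : ℚ_[p]) ∧
      (B : ℚ_[p]) = ((legendreHarmonic n : ℚ) : ℚ_[p]) ∧
      PadicInt.toZModPow 2 A = PadicInt.toZModPow 2 B := by
  have hu := (inv_two_four p hp).1
  set u : ℤ_[p] := PadicInt.inv 2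
  have hu' : (u : ℚ_[p]) = 1 / 2 := by
    have := congrArg (fun z : ℤ_[p] => (z : ℚ_[p])) hu
    push_cast at this
    rw [eq_div_iff two_ne_zero, mul_comm]
    exact this
  refine ⟨∑ k ∈ Finset.range p, ((2 * k).choose k : ℤ_[p]) ^ 2 * (u ^ 5) ^ k * padicHarmonic p k,
    ∑ k ∈ Finset.range p, ((n + k).choose (2 * k) : ℤ_[p]) * (2 * k).choose k * (-u) ^ k *
      padicHarmonic p k, ?_, ?_, ?_⟩
  · rw [PadicInt.coe_sum, Rat.cast_sum]
    refine Finset.sum_congr rfl fun k hk => ?_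
    push_cast
    rw [coe_padicHarmonic (Finset.mem_range.1 hk), hu', div_eq_mul_inv _ ((32 : ℚ_[p]) ^ k),
      ← inv_pow, show (32 : ℚ_[p])⁻¹ = (1 / 2) ^ 5 by norm_num]
    ring
  · rw [legendreHarmonic, sum_legendreCoeff_mul n p (by omega), PadicInt.coe_sum, Rat.cast_sum]
    refine Finset.sum_congr rfl fun k hk => ?_
    unfold legendreCoeff
    push_cast
    rw [coe_padicHarmonic (Finset.mem_range.1 hk), hu', neg_div]
  · rw [toZModPow_eq_iff_dvd, ← Finset.sum_sub_distrib]
    refine Finset.dvd_sum fun k hk => ?_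
    obtain ⟨c, hc⟩ := choose_two_mul_sq_modEq hn (Finset.mem_range.1 hk)
    have h1 : (-u) ^ k = (-16) ^ k * (u ^ 5) ^ k := by
      rw [← mul_pow]
      congr 1
      linear_combination u * (8 * u ^ 3 + 4 * u ^ 2 + 2 * u + 1) * hu
    exact ⟨c * (u ^ 5) ^ k * padicHarmonic p k, by
      rw [h1]; linear_combination (u ^ 5) ^ k * padicHarmonic p k * hc⟩

theorem exists_fermatQuotient_two (hp : 2 < p) :
    ∃ q : ℤ_[p], (q : ℚ_[p]) = ((fermatQuotient p 2 : ℚ) : ℚ_[p]) ∧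
      (2 : ℤ_[p]) ^ (p - 1) = 1 + p * q := by
  have h2 : ((2 : ℕ) : ZMod p) ≠ 0 := by
    rw [Ne, ZMod.natCast_eq_zero_iff]
    exact fun h => absurd (Nat.le_of_dvd (by norm_num) h) (by omega)
  have h : (p : ℤ_[p]) ∣ 2 ^ (p - 1) - 1 := by
    have := ZMod.pow_card_sub_one_eq_one h2
    rw [dvd_iff_toZMod_eq_zero, map_sub, map_pow, map_ofNat, map_one, sub_eq_zero]
    exact_mod_cast this
  obtain ⟨q, hq⟩ := h
  have hp0 : (p : ℚ_[p]) ≠ 0 := by exact_mod_cast (Fact.out : p.Prime).ne_zero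
  refine ⟨q, ?_, by linear_combination hq⟩
  have := congrArg (fun z : ℤ_[p] => (z : ℚ_[p])) hq
  push_cast at this
  unfold fermatQuotient
  push_cast
  rw [eq_div_iff hp0, mul_comm]
  exact this.symm

theorem toZModPow_two_mul_eq_of_dvd {x y : ℤ_[p]} (h : (p : ℤ_[p]) ∣ x - y) :
    (p : ZMod (p ^ 2)) * PadicInt.toZModPow 2 x = p * PadicInt.toZModPow 2 y := by
  rw [← map_natCast (PadicInt.toZModPow (p := p) 2), ← map_mul, ← map_mul, toZModPow_eq_iff_dvd,
    ← mul_sub, sq]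
  exact mul_dvd_mul_left _ h

theorem natCast_sq_zmod_sq (p : ℕ) : (p : ZMod (p ^ 2)) ^ 2 = 0 := by
  exact_mod_cast ZMod.natCast_self (p ^ 2)

/-- Gathers what both residue classes of `p` modulo 4 need; only `s` and the product identity `h`
differ between them. The last relation is a congruence modulo `p`, multiplied by `p`. -/
theorem toZModPow_harmonic_relations (hp : 3 < p) {n m : ℕ} (hn : p = 2 * n + 1) {q s : ℤ_[p]}
    (hm : m < p) (hq : (2 : ℤ_[p]) ^ (p - 1) = 1 + p * q) (hs : s ^ 2 = 4 ^ n)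
    (h : ((m.factorial : ℕ) : ℤ_[p]) * ∏ j ∈ Finset.range n, (((j + 1 : ℕ) : ℤ_[p]) + -p) =
      s * (n.factorial : ℤ_[p]) *
        ∏ j ∈ Finset.range m, (((j + 1 : ℕ) : ℤ_[p]) + -((p : ℤ_[p]) * PadicInt.inv 2))) :
    PadicInt.toZModPow 2 (padicHarmonic p n) = PadicInt.toZModPow 2 (-(2 * q - (p : ℤ_[p]) * q ^ 2)) ∧
    1 - (p : ZMod (p ^ 2)) * PadicInt.toZModPow 2 (padicHarmonic p n) =
      PadicInt.toZModPow 2 s * (1 - (p : ZMod (p ^ 2)) * PadicInt.toZModPow 2 (PadicInt.inv 2) *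
        PadicInt.toZModPow 2 (padicHarmonic p m)) ∧
    2 * ((p : ZMod (p ^ 2)) * PadicInt.toZModPow 2 (padicHarmonic p m)) =
      3 * ((p : ZMod (p ^ 2)) * PadicInt.toZModPow 2 (padicHarmonic p n)) := by
  have hq' : (4 : ℤ_[p]) ^ n = 1 + p * q := by
    rw [← hq, show p - 1 = 2 * n by omega, pow_mul]
    norm_num
  obtain ⟨r, hr⟩ := exists_one_sub_harmonic_eq (by omega) hm h
  refine ⟨?_, ?_, ?_⟩
  · rw [toZModPow_eq_iff_dvd]
    refine (sq_dvd_padicHarmonic_half hp hn hq').trans (dvd_of_eq ?_)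
    ring
  · have h1 := congrArg (PadicInt.toZModPow (p := p) 2) hr
    simp only [map_add, map_sub, map_mul, map_one, map_natCast, map_pow _ (p : ℤ_[p]),
      natCast_sq_zmod_sq, zero_mul, add_zero] at h1
    exact h1
  · have h1 := toZModPow_two_mul_eq_of_dvd (dvd_two_mul_padicHarmonic_sub hp hn hq' hs hr)
    simp only [map_mul, map_ofNat] at h1
    linear_combination h1

end

section
variable {p : ℕ} [Fact p.Prime]

theorem isUnit_natCast_zmod_sq_of_factorial {k : ℕ} (hk : k < p) :
    IsUnit ((k.factorial : ℕ) : ZMod (p ^ 2)) := by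
  simpa using (isUnit_factorial_padicInt hk).map (PadicInt.toZModPow (p := p) 2)

theorem isUnit_neg_four_zmod_sq (hp : 3 < p) : IsUnit (-4 : ZMod (p ^ 2)) := by
  have h := congrArg (PadicInt.toZModPow (p := p) 2) (inv_two_four p hp).2
  rw [map_mul, map_ofNat, map_one] at h
  exact (IsUnit.of_mul_eq_one _ h).neg

theorem legendreHarmonic_modEq_of_mod_four_eq_one (hp : 3 < p) {m : ℕ} (hm : p = 4 * m + 1)
    {B q : ℤ_[p]} (hB : (B : ℚ_[p]) = ((legendreHarmonic (2 * m) : ℚ) : ℚ_[p]))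
    (hq : (2 : ℤ_[p]) ^ (p - 1) = 1 + p * q) :
    PadicInt.toZModPow 2 B = PadicInt.toZModPow 2 (padicGamma p (PadicInt.inv 2) *
      padicGamma p (PadicInt.inv 4) ^ 2 * (2 * q - (p : ℤ_[p]) * q ^ 2)) := by
  obtain ⟨hu, hu4⟩ := inv_two_four p hp
  have hid := prod_sub_prime_even_odd hu m
  rw [← hm] at hid
  have hs : ((-4 : ℤ_[p]) ^ m) ^ 2 = 4 ^ (2 * m) := by
    rw [← pow_mul, mul_comm m 2, pow_mul, pow_mul]
    norm_num
  obtain ⟨hH, hC, hD⟩ := toZModPow_harmonic_relations hp (n := 2 * m) (by omega) (by omega) hq hs hid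
  have hB' : B * ((-4) ^ m * (m.factorial : ℤ_[p]) ^ 2) =
      (2 * m).factorial * padicHarmonic p (2 * m) := by
    apply PadicInt.ext
    have h := congrArg (Rat.cast : ℚ → ℚ_[p]) (legendreZero_even m)
    rw [legendreHarmonic_even] at hB
    push_cast at h hB ⊢
    rw [hB, coe_padicHarmonic (by omega), show ((4 : ℤ_[p]) : ℚ_[p]) = 4 from rfl]
    linear_combination ((harmonic (2 * m) : ℚ) : ℚ_[p]) * h
  -- `2(p·2m + 1 + 2m) = p² + 1`, and `4(p·3m + 1 + 3m) = 3p² + 1` for the next value.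
  have hG2 := toZModPow_padicGamma_inv (p := p) (d := 2) (t := 2 * m) (a := 2 * m) (c := 1)
    (by omega) (by exact_mod_cast hu) (by omega) (by subst hm; ring)
  have hG4 := toZModPow_padicGamma_inv (p := p) (d := 4) (t := 3 * m) (a := 3 * m) (c := 3)
    (by omega) (by exact_mod_cast hu4) (by omega) (by subst hm; ring)
  have hsgn : (-1 : ZMod (p ^ 2)) ^ (p * (2 * m) + 1 + 2 * m) = -1 :=
    Odd.neg_one_pow ⟨p * m + m, by ring⟩
  have hsgn' : ((-1 : ZMod (p ^ 2)) ^ (p * (3 * m) + 1 + 3 * m)) ^ 2 = 1 := by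
    rw [← pow_mul, mul_comm, pow_mul, neg_one_sq, one_pow]
  have hW := factorial_pred_eq (p := p) (a := 3 * m) (b := m) (by omega)
  have hWp := factorial_pred_pow_prime (p := p) (by omega)
  -- `Γ_p(1/4)` produces `H_{3m}`; since `3m = p - 1 - m`, it equals `H_m` modulo `p`.
  have hrefl := toZModPow_two_mul_eq_of_dvd
    (dvd_padicHarmonic_reflect (p := p) (by omega) (k := m) (by omega))
  rw [show p - 1 - m = 3 * m by omega] at hrefl
  have hem : (p : ZMod (p ^ 2)) = 4 * (m : ZMod (p ^ 2)) + 1 := by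
    have := congrArg (Nat.cast : ℕ → ZMod (p ^ 2)) hm
    push_cast at this
    exact this
  have hu' := congrArg (PadicInt.toZModPow (p := p) 2) hu
  rw [map_mul, map_ofNat, map_one] at hu'
  have hB2 := congrArg (PadicInt.toZModPow (p := p) 2) hB'
  simp only [map_mul, map_pow, map_natCast, map_neg, map_ofNat] at hB2
  rw [map_pow, map_neg, map_ofNat] at hC
  generalize hWd : ((p - 1).factorial : ZMod (p ^ 2)) = W at *
  -- The exponent is `8m + 2 = 2p`.
  have hWp' : (W ^ (2 * m)) ^ 4 * W ^ 2 = 1 := by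
    have h : (W ^ (2 * m)) ^ 4 * W ^ 2 = (W ^ p) ^ 2 := by
      rw [← pow_mul, ← pow_mul, ← pow_add]
      congr 1
      omega
    rw [h, hWp, neg_one_sq]
  have hW2 : W ^ 2 = ((3 * m).factorial : ZMod (p ^ 2)) ^ 2 * (m.factorial : ZMod (p ^ 2)) ^ 2 *
      (1 - (p : ZMod (p ^ 2)) * PadicInt.toZModPow 2 (padicHarmonic p m)) ^ 2 := by
    have h1 : ((-1 : ZMod (p ^ 2)) ^ m) ^ 2 = 1 := by
      rw [← pow_mul, mul_comm, pow_mul, neg_one_sq, one_pow]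
    rw [hW]
    linear_combination ((3 * m).factorial : ZMod (p ^ 2)) ^ 2 * (m.factorial : ZMod (p ^ 2)) ^ 2 *
      (1 - (p : ZMod (p ^ 2)) * PadicInt.toZModPow 2 (padicHarmonic p m)) ^ 2 * h1
  have key := gamma_product_even (Z := W ^ (3 * m)) (F₂ := ((2 * m).factorial : ZMod (p ^ 2)))
    (natCast_sq_zmod_sq p) hem hu' hWp' (by ring) hW2 hC hrefl hD
  apply (((isUnit_neg_four_zmod_sq hp).pow m).mul
    ((isUnit_natCast_zmod_sq_of_factorial (p := p) (k := m) (by omega)).pow 2)).mul_right_cancel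
  rw [hB2, hH, ← key]
  simp only [map_mul, map_pow _ (padicGamma p _), map_neg]
  rw [hG2, hG4, hsgn]
  push_cast
  linear_combination (-(W ^ (2 * m) * (2 * m).factorial * (1 + p * (2 * m) *
    PadicInt.toZModPow 2 (padicHarmonic p (2 * m))))) * (W ^ (3 * m) * (3 * m).factorial *
    (1 + p * (3 * m) * PadicInt.toZModPow 2 (padicHarmonic p (3 * m)))) ^ 2 *
    ((-4) ^ m * (m.factorial : ZMod (p ^ 2)) ^ 2) *
    PadicInt.toZModPow 2 (2 * q - (p : ℤ_[p]) * q ^ 2) * (-hsgn')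

theorem legendreHarmonic_modEq_of_mod_four_eq_three (hp : 3 < p) {m : ℕ} (hm : p = 4 * m + 3)
    {B : ℤ_[p]} (hB : (B : ℚ_[p]) = ((legendreHarmonic (2 * m + 1) : ℚ) : ℚ_[p])) :
    PadicInt.toZModPow 2 B = PadicInt.toZModPow 2 (PadicInt.inv 2 *
      padicGamma p (PadicInt.inv 2) * padicGamma p (PadicInt.inv 4) ^ 2) := by
  obtain ⟨hu, hu4⟩ := inv_two_four p hp
  obtain ⟨q, -, hq⟩ := exists_fermatQuotient_two (p := p) (by omega)
  have hid := prod_sub_prime_even_odd' hu m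
  rw [← hm] at hid
  have hs : (-2 * (-4 : ℤ_[p]) ^ m) ^ 2 = 4 ^ (2 * m + 1) := by
    rw [mul_pow, ← pow_mul, mul_comm m 2, pow_mul, pow_succ 4 (2 * m), pow_mul]
    norm_num
    ring
  obtain ⟨-, hC, hD⟩ := toZModPow_harmonic_relations hp (n := 2 * m + 1) (by omega) (by omega)
    hq hs hid
  have hB' : B * (2 * m + 1).factorial = -((-4) ^ m * (m.factorial : ℤ_[p]) ^ 2) := by
    apply PadicInt.ext
    have h := congrArg (Rat.cast : ℚ → ℚ_[p]) (legendreHarmonic_odd m)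
    push_cast at h hB ⊢
    rw [hB]
    exact h
  have hG2 := toZModPow_padicGamma_inv (p := p) (d := 2) (t := 2 * m + 1) (a := 2 * m + 1) (c := 1)
    (by omega) (by exact_mod_cast hu) (by omega) (by subst hm; ring)
  -- `4(p(3m+2) + 1 + m) = p(3p-1) + p + 1 = 3p² + 1`; the remainder is `m` itself, so no reflection
  -- is needed.
  have hG4 := toZModPow_padicGamma_inv (p := p) (d := 4) (t := 3 * m + 2) (a := m) (c := 3)
    (by omega) (by exact_mod_cast hu4) (by omega) (by subst hm; ring)
  have hsgn : (-1 : ZMod (p ^ 2)) ^ (p * (2 * m + 1) + 1 + (2 * m + 1)) = -1 :=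
    Odd.neg_one_pow ⟨(4 * m + 3) * m + (2 * m + 1) + m + 1, by rw [hm]; ring⟩
  have hsgn' : ((-1 : ZMod (p ^ 2)) ^ (p * (3 * m + 2) + 1 + m)) ^ 2 = 1 := by
    rw [← pow_mul, mul_comm, pow_mul, neg_one_sq, one_pow]
  have hW := factorial_pred_eq (p := p) (a := 2 * m + 1) (b := 2 * m + 1) (by omega)
  have hWp := factorial_pred_pow_prime (p := p) (by omega)
  have hem : (p : ZMod (p ^ 2)) = 4 * (m : ZMod (p ^ 2)) + 3 := by
    have := congrArg (Nat.cast : ℕ → ZMod (p ^ 2)) hm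
    push_cast at this
    exact this
  have hu' := congrArg (PadicInt.toZModPow (p := p) 2) hu
  rw [map_mul, map_ofNat, map_one] at hu'
  have hB2 := congrArg (PadicInt.toZModPow (p := p) 2) hB'
  simp only [map_mul, map_pow, map_natCast, map_neg, map_ofNat] at hB2
  rw [map_mul, map_pow, map_neg, map_neg, map_ofNat, map_ofNat] at hC
  rw [Odd.neg_one_pow ⟨m, rfl⟩] at hW
  have hF := isUnit_natCast_zmod_sq_of_factorial (p := p) (k := 2 * m + 1) (by omega)
  generalize hWd : ((p - 1).factorial : ZMod (p ^ 2)) = W at *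
  have hWp' : W ^ (2 * m + 1) * (W ^ (3 * m + 2)) ^ 2 * W = 1 := by
    have h : W ^ (2 * m + 1) * (W ^ (3 * m + 2)) ^ 2 * W = (W ^ p) ^ 2 := by
      rw [← pow_mul, ← pow_mul, ← pow_add, ← pow_succ]
      congr 1
      omega
    rw [h, hWp, neg_one_sq]
  have key := gamma_product_odd (F₁ := (m.factorial : ZMod (p ^ 2)))
    (F₂ := ((2 * m + 1).factorial : ZMod (p ^ 2)))
    (natCast_sq_zmod_sq p) hem hu' hWp' (by rw [hW]; ring) hC hD
  apply hF.mul_right_cancel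
  rw [hB2]
  simp only [map_mul, map_pow _ (padicGamma p _)]
  rw [hG2, hG4, hsgn]
  push_cast
  linear_combination -PadicInt.toZModPow 2 (PadicInt.inv 2 : ℤ_[p]) * key +
    (-4) ^ m * (m.factorial : ZMod (p ^ 2)) ^ 2 * hu' +
    PadicInt.toZModPow 2 (PadicInt.inv 2 : ℤ_[p]) * (-(W ^ (2 * m + 1) * (2 * m + 1).factorial *
    (1 + p * (2 * m + 1) * PadicInt.toZModPow 2 (padicHarmonic p (2 * m + 1))))) *
    (W ^ (3 * m + 2) * m.factorial *
    (1 + p * (3 * m + 2) * PadicInt.toZModPow 2 (padicHarmonic p m))) ^ 2 *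
    (2 * m + 1).factorial * (-hsgn')

end

theorem mainTheorem4 (p : ℕ) [Fact p.Prime] (hp : 3 < p) :
    (p % 4 = 1 →
      PadicModEq p 2
        ((∑ k ∈ Finset.range p,
          ((2 * k).choose k : ℚ) ^ 2 * (harmonic k / (32 : ℚ) ^ k) : ℚ) : ℚ_[p])
        ((padicGamma p (PadicInt.inv 2) : ℚ_[p]) * (padicGamma p (PadicInt.inv 4) : ℚ_[p]) ^ 2 *
          ((2 * fermatQuotient p 2 - p * fermatQuotient p 2 ^ 2 : ℚ) : ℚ_[p]))) ∧
    (p % 4 = 3 →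
      PadicModEq p 2
        ((∑ k ∈ Finset.range p,
          ((2 * k).choose k : ℚ) ^ 2 * (harmonic k / (32 : ℚ) ^ k) : ℚ) : ℚ_[p])
        (1 / 2 * (padicGamma p (PadicInt.inv 2) : ℚ_[p]) *
          (padicGamma p (PadicInt.inv 4) : ℚ_[p]) ^ 2)) := by
  refine ⟨fun h => ?_, fun h => ?_⟩
  · obtain ⟨m, hm⟩ : ∃ m, p = 4 * m + 1 := ⟨p / 4, by omega⟩
    obtain ⟨A, B, hA, hB, hAB⟩ := exists_padicInt_sums hp (n := 2 * m) (by omega)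
    obtain ⟨q, hqf, hq⟩ := exists_fermatQuotient_two (p := p) (by omega)
    rw [legendreHarmonic_modEq_of_mod_four_eq_one hp hm hB hq, ← padicModEq_coe_iff, hA] at hAB
    push_cast at hAB ⊢
    rw [hqf] at hAB
    exact hAB
  · obtain ⟨m, hm⟩ : ∃ m, p = 4 * m + 3 := ⟨p / 4, by omega⟩
    obtain ⟨A, B, hA, hB, hAB⟩ := exists_padicInt_sums hp (n := 2 * m + 1) (by omega)
    have hu : ((PadicInt.inv 2 : ℤ_[p]) : ℚ_[p]) = 1 / 2 := by
      have := congrArg (fun z : ℤ_[p] => (z : ℚ_[p])) (inv_two_four p hp).1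
      push_cast at this
      rw [eq_div_iff two_ne_zero, mul_comm]
      exact this
    rw [legendreHarmonic_modEq_of_mod_four_eq_three hp hm hB, ← padicModEq_coe_iff, hA] at hAB
    push_cast at hAB ⊢
    rw [hu] at hAB
    exact hAB
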